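/- Let $m\in\mathbb N$ and let $\chi$ be a non-principal real primitive Dirichlet character to modulus $m$. Let $a=0$ if $\chi(-1)=1$ and $a=1$ if $\chi(-1)=-1$. Put $$\Xi(z,\chi)=\Big(\frac{\pi}{m}\Big)^{-(1+2a+2iz)/4}\,\Gamma\Big(\frac{1+2a+2iz}{4}\Big)\,L\Big(\frac{1+2iz}{2},\chi\Big),$$ an entire function of $z$ (removable singularities being filled in), and, for $t\in\mathbb R$ and $\nu\in\mathbb N_0$, $$\phi(t,\chi)=\sum_{n=-\infty}^{\infty}n^{a}\chi(n)\exp\Big(-\frac{n^{2}\pi}{me^{2t}}-\frac{1+2a}{2}\,t\Big),\qquad b_{\nu}(\chi)=\int_{-\infty}^{\infty}t^{\nu}\phi(t,\chi)\,dt .$$ Assume that $\phi(t,\chi)\ge 0$ for all $t\in\mathbb R$. Then all integrals $b_\nu(\chi)$ converge absolutely, $b_0(\chi)>0$, and $\Xi(\cdot,\chi)$ has infinitely many zeros with positive real part. Let $z_1(\chi),z_2(\chi),\dots$ be a list of all of these, each repeated according to its multiplicity, in any order, and put $$p_n(\chi)=\sum_{k=1}^{\infty}\frac{1}{z_k(\chi)^{2n}},\qquad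 n\in\mathbb N=\{1,2,\dots\}.$$ Then the following hold. 1. The generalized Riemann hypothesis for $L(s,\chi)$ (every zero $s$ of $L(s,\chi)$ with $0<\Re s<1$ has $\Re s=\tfrac12$) is true if and only if, for some real $\lambda\ge\sup\{|z_k(\chi)|^{-2} : k\in\mathbb N\}$, $$(-1)^{j}\Delta^{j}\Big(\frac{p_{k+1}(\chi)}{\lambda^{k+1}}\Big)\ge 0\qquad\text{for all } j,k\in\mathbb N_0,$$ where $\Delta u_k=u_{k+1}-u_k$ (that is, these numbers are real and nonnegative). 2. For every $n\in\mathbb N$ the series $p_n(\chi)$ converges absolutely, the function $z\mapsto\log\big(\Xi(\sqrt z,\chi)/\Xi(0,\chi)\big)$ (with the principal branch of $\log$; the branch of $\sqrt z$ does not matter as $\Xi(\cdot,\chi)$ is even) is analytic at $0$, and $$p_n(\chi)=\frac{-1}{(n-1)!}\,\frac{\partial^{n}}{\partial z^{n}}\Big(\log\frac{\Xi(\sqrt z,\chi)}{\Xi(0,\chi)}\Big)\Big|_{z=0}.$$ 3. Writing $b_\nu=b_\nu(\chi)$, $$p_1(\chi)=\frac{b_2}{2b_0},\qquad p_2(\chi)=\frac{3b_2^2-b_0b_4}{12b_0^2},\qquad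 p_3(\chi)=\frac{30b_2^3-15b_0b_2b_4+b_0^2b_6}{240b_0^3}.$$ 4. For every $k\in\mathbb N$, $$p_k(\chi)=\frac{(-1)^{k-1}k\,b_{2k}}{(2k)!\,b_0}+\sum_{i=1}^{k-1}\frac{(-1)^{k-1+i}b_{2k-2i}}{(2k-2i)!\,b_0}\,p_i(\chi)$$ and $$p_k(\chi)=\sum_{\substack{r_1,\dots,r_k\ge 0\\ r_1+2r_2+\cdots+kr_k=k}}(-1)^k\,\frac{k\,(r_1+\cdots+r_k-1)!}{r_1!\,r_2!\cdots r_k!}\prod_{i=1}^{k}\Big(\frac{-b_{2i}}{(2i)!\,b_0}\Big)^{r_i}.$$ -/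

import Mathlib

open scoped ComplexOrder

noncomputable section

namespace RealCharXi

variable {m : ℕ} [NeZero m]

open scoped Classical in
/-- The parity `a` of a Dirichlet character: `0` if `χ (-1) = 1` and `1` otherwise. -/
def parity (χ : DirichletCharacter ℂ m) : ℕ := if χ (-1) = 1 then 0 else 1

/-- The function `Ξ(z, χ)`, that is
`(π/m)^(-(1+2a+2iz)/4) Γ((1+2a+2iz)/4) L((1+2iz)/2, χ)`,
written with Mathlib's completed `L`-function, so that the removable singularities at the poles of
the Gamma factor are filled in. The lemma `Xi_eq` below identifies the two. -/
def Xi (χ : DirichletCharacter ℂ m) (z : ℂ) : ℂ :=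
  (m : ℂ) ^ ((1 + 2 * (parity χ : ℂ) + 2 * Complex.I * z) / 4) *
    DirichletCharacter.completedLFunction χ ((1 + 2 * Complex.I * z) / 2)

/-- Away from the poles of the Gamma factor, `Ξ(z, χ)` is given by the usual product. -/
theorem Xi_eq (χ : DirichletCharacter ℂ m) (hχ : χ ≠ 1) (z : ℂ)
    (hz : ∀ n : ℕ, (1 + 2 * (parity χ : ℂ) + 2 * Complex.I * z) / 4 ≠ -(n : ℂ)) :
    Xi χ z = ((Real.pi / m : ℝ) : ℂ) ^ (-((1 + 2 * (parity χ : ℂ) + 2 * Complex.I * z) / 4)) *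
      Complex.Gamma ((1 + 2 * (parity χ : ℂ) + 2 * Complex.I * z) / 4) *
      DirichletCharacter.LFunction χ ((1 + 2 * Complex.I * z) / 2) := by
  set w : ℂ := (1 + 2 * (parity χ : ℂ) + 2 * Complex.I * z) / 4 with hw
  set s : ℂ := (1 + 2 * Complex.I * z) / 2 with hs
  have hm1 : m ≠ 1 := by
    rintro rfl
    exact hχ (DirichletCharacter.level_one χ)
  have hm : (0 : ℝ) < m := by exact_mod_cast Nat.pos_of_ne_zero (NeZero.ne m)
  have hmc : (m : ℂ) ≠ 0 := by exact_mod_cast hm.ne'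
  have hg : DirichletCharacter.gammaFactor χ s = (Real.pi : ℂ) ^ (-w) * Complex.Gamma w := by
    by_cases h : χ (-1) = 1
    · have he : χ.Even := h
      have h2 : s / 2 = w := by simp [hw, hs, parity, h]; ring
      rw [he.gammaFactor_def, Complex.Gammaℝ_def, neg_div, h2]
    · have ho : χ.Odd := χ.even_or_odd.resolve_left h
      have h2 : (s + 1) / 2 = w := by simp [hw, hs, parity, h]; ring
      rw [ho.gammaFactor_def, Complex.Gammaℝ_def, neg_div, h2]
  have hpi : (Real.pi : ℂ) ≠ 0 := by exact_mod_cast Real.pi_ne_zero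
  have hg0 : DirichletCharacter.gammaFactor χ s ≠ 0 := by
    rw [hg]
    exact mul_ne_zero (by simp [Complex.cpow_eq_zero_iff, hpi]) (Complex.Gamma_ne_zero hz)
  have hL := DirichletCharacter.LFunction_eq_completed_div_gammaFactor χ s (Or.inr hm1)
  have hpow : ((Real.pi / m : ℝ) : ℂ) ^ (-w) = (Real.pi : ℂ) ^ (-w) * (m : ℂ) ^ w := by
    rw [div_eq_mul_inv, Complex.ofReal_mul, Complex.mul_cpow_ofReal_nonneg Real.pi_pos.le
      (inv_nonneg.mpr hm.le), Complex.cpow_neg ((m : ℝ)⁻¹ : ℝ), Complex.ofReal_inv,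
      Complex.inv_cpow, inv_inv, Complex.ofReal_natCast]
    rw [Complex.ofReal_natCast, Complex.natCast_arg]
    exact Real.pi_pos.ne
  have hc : DirichletCharacter.completedLFunction χ s =
      DirichletCharacter.gammaFactor χ s * DirichletCharacter.LFunction χ s := by
    rw [hL]; field_simp
  rw [Xi, ← hw, ← hs, hc, hg, hpow]
  ring

/-- The kernel `φ(t, χ) = ∑_{n ∈ ℤ} n^a χ(n) exp(-n²π/(m e^{2t}) - (1+2a)t/2)` of a real
character `χ` (so that `re` only serves to read `χ(n)` as a real number). It is the even function
with `Ξ(z, χ) = ∫ e^{-izt} φ(t, χ) dt`. -/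
def phi (χ : DirichletCharacter ℂ m) (t : ℝ) : ℝ :=
  ∑' n : ℤ, (n : ℝ) ^ parity χ * (χ (n : ZMod m)).re *
    Real.exp (-((n : ℝ) ^ 2 * Real.pi / (m * Real.exp (2 * t))) -
      (1 + 2 * (parity χ : ℝ)) / 2 * t)

/-- The moment `b_n(χ) = ∫ t^n φ(t, χ) dt` over the real line. -/
def b (χ : DirichletCharacter ℂ m) (n : ℕ) : ℝ := ∫ t : ℝ, t ^ n * phi χ t

/-- `z` lists the zeros of `Ξ(·, χ)` with positive real part, each one as often as its multiplicity
says (in any order). -/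
structure IsZeroList (χ : DirichletCharacter ℂ m) (z : ℕ → ℂ) : Prop where
  re_pos : ∀ k, 0 < (z k).re
  isZero : ∀ k, Xi χ (z k) = 0
  multiplicity : ∀ w : ℂ, 0 < w.re → Xi χ w = 0 →
    {k : ℕ | z k = w}.encard = analyticOrderAt (Xi χ) w

/-- The power sum `∑ₖ 1 / z_k^(2n)`. -/
def powerSum (z : ℕ → ℂ) (n : ℕ) : ℂ := ∑' k : ℕ, 1 / z k ^ (2 * n)

/-- The generalized Riemann hypothesis for `L(s, χ)`: all zeros in the critical strip lie on the
critical line. -/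
def GRH (χ : DirichletCharacter ℂ m) : Prop :=
  ∀ s : ℂ, 0 < s.re → s.re < 1 → DirichletCharacter.LFunction χ s = 0 → s.re = 1 / 2

/-- `(-1)^j Δ^j u_k ≥ 0` for all `j, k ≥ 0`, where `Δ u_k = u_{k+1} - u_k`. In the order on `ℂ`,
`0 ≤ w` says that `w` is real and nonnegative. -/
def IsCompletelyMonotone (u : ℕ → ℂ) : Prop :=
  ∀ j k : ℕ, 0 ≤ (-1 : ℂ) ^ j * ((fwdDiff 1)^[j] u) k

/-- The tuples `(r_1, …, r_k)` of natural numbers with `r_1 + 2 r_2 + ⋯ + k r_k = k`; the entry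
`r_{i+1}` is `r i`. (The equation forces every entry to be at most `k`.) -/
def weightedTuples (k : ℕ) : Finset (Fin k → ℕ) :=
  {r ∈ Fintype.piFinset (fun _ : Fin k => Finset.range (k + 1)) |
    ∑ i : Fin k, ((i : ℕ) + 1) * r i = k}

theorem mem_weightedTuples {k : ℕ} {r : Fin k → ℕ} :
    r ∈ weightedTuples k ↔ ∑ i : Fin k, ((i : ℕ) + 1) * r i = k := by
  simp only [weightedTuples, Finset.mem_filter, Fintype.mem_piFinset, Finset.mem_range,
    and_iff_right_iff_imp]
  intro h i
  have h1 : ((i : ℕ) + 1) * r i ≤ ∑ i : Fin k, ((i : ℕ) + 1) * r i :=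
    Finset.single_le_sum (f := fun i : Fin k => ((i : ℕ) + 1) * r i)
      (fun _ _ => Nat.zero_le _) (Finset.mem_univ i)
  nlinarith [Nat.zero_le ((i : ℕ) * r i)]

end RealCharXi

end

/-! `Xi χ` is the Fourier transform of the kernel `phi χ` (`Xi_eq_phiTransform`). The kernel decays
doubly exponentially, so all moments exist, they are up to normalisation the Taylor coefficients of
Ξ, and |Ξ(z)| is at most a constant times exp(|z|^(4/3)). Positivity of the kernel gives Ξ(0) = b₀ >
0, which forces the root number to be 1 and Ξ to be even (`Xi_neg`), excludes zeros on the imaginary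
axis, and makes every even moment positive. Hence F(w) = Ξ(√w)/Ξ(0) is entire, F(0) = 1, its order
is at most 2/3, and its zeros are exactly the z_k² with the same multiplicities.

For such an F the Taylor coefficients of log F are power sums of inverse zeros
(`ZeroFamily.tsum_eq`). No Hadamard product is needed: divide out the zeros of modulus at most R,
bound the quotient by the maximum principle and its logarithm by Borel–Carathéodory; the n-th
coefficient that remains is O(R^(ρ-n)), which tends to 0 because ρ < 1 ≤ n. With finitely many zeros
F would be a polynomial, but none of its Taylor coefficients vanishes. The relation F' = (log F)' F
is Newton's recurrence, and a generating series solves it in closed form.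

GRH says that all z_k are real, that is, all x_k = 1/(λ z_k²) are nonnegative. The signed
differences are Σ x_k^(i+1) (1 - x_k)^j, so one direction is immediate. Conversely, Λ(p) = Re Σ x_k
p(x_k) is nonnegative on polynomials that are nonnegative on [0, 1], by Bernstein expansion
(`nonneg_of_nonneg_on_Icc`); an x_k off [0, ∞) would allow a real polynomial q with Λ(q²) < 0
(`nonneg_of_moments`). -/

namespace EntirePowerSum

/-! ### Power sums of inverse zeros of entire functions of order less than one. -/

open Filter Topology Complex Metric

variable {ι : Type*}

theorem analyticOrderAt_one_sub_div {a : ℂ} (ha : a ≠ 0) (w : ℂ) :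
    analyticOrderAt (fun z : ℂ => 1 - z / a) w = if a = w then 1 else 0 := by
  have han : AnalyticAt ℂ (fun z : ℂ => 1 - z / a) w := by fun_prop (disch := exact ha)
  split_ifs with h
  · subst h
    refine han.analyticOrderAt_eq_one_of_zero_deriv_ne_zero (by simp [ha]) ?_
    have : HasDerivAt (fun z : ℂ => 1 - z / a) (-(1 / a)) a :=
      ((hasDerivAt_id a).div_const a).const_sub 1
    rw [this.deriv]
    simpa using ha
  · refine han.analyticOrderAt_eq_zero.mpr fun h0 => h ?_
    rw [sub_eq_zero, eq_div_iff ha, one_mul] at h0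
    exact h0

theorem analyticAt_prod_one_sub_div {a : ι → ℂ} (s : Finset ι) (w : ℂ) :
    AnalyticAt ℂ (fun z : ℂ => ∏ i ∈ s, (1 - z / a i)) w := by
  refine Finset.analyticAt_fun_prod s fun i _ => ?_
  simp only [div_eq_mul_inv]
  fun_prop

theorem analyticOrderAt_prod_one_sub_div [DecidableEq ι] {a : ι → ℂ} (ha : ∀ i, a i ≠ 0)
    (s : Finset ι) (w : ℂ) :
    analyticOrderAt (fun z : ℂ => ∏ i ∈ s, (1 - z / a i)) w =
      ((s.filter (fun i => a i = w)).card : ℕ∞) := by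
  induction s using Finset.induction_on with
  | empty => simp [analyticOrderAt_eq_zero]
  | insert i s hi ih =>
    have : (fun z : ℂ => ∏ j ∈ insert i s, (1 - z / a j)) =
        (fun z : ℂ => 1 - z / a i) * fun z : ℂ => ∏ j ∈ s, (1 - z / a j) := by
      ext z; simp [Finset.prod_insert hi]
    rw [this, analyticOrderAt_mul (by fun_prop (disch := exact ha i))
      (analyticAt_prod_one_sub_div s w), ih, analyticOrderAt_one_sub_div (ha i),
      Finset.filter_insert]
    split_ifs with h
    · rw [Finset.card_insert_of_notMem (by simp [hi])]
      push_cast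
      ring
    · simp

/-- Zeros of an entire function, counted with multiplicity, can be divided out. -/
theorem exists_eq_prod_mul [DecidableEq ι] {f : ℂ → ℂ} (hf : Differentiable ℂ f) {a : ι → ℂ}
    (ha : ∀ i, a i ≠ 0) (s : Finset ι)
    (hs : ∀ w, ((s.filter (fun i => a i = w)).card : ℕ∞) ≤ analyticOrderAt f w) :
    ∃ g : ℂ → ℂ, Differentiable ℂ g ∧ ∀ w, f w = (∏ i ∈ s, (1 - w / a i)) * g w := by
  induction s using Finset.induction_on with
  | empty => exact ⟨f, hf, fun w => by simp⟩
  | insert i s hi ih =>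
    obtain ⟨g, hg, hfg⟩ := ih fun w => le_trans (by
      gcongr
      exact Finset.subset_insert i s) (hs w)
    have hfe : f = (fun z : ℂ => ∏ j ∈ s, (1 - z / a j)) * g := funext hfg
    have h0 : g (a i) = 0 := by
      by_contra hne
      have h1 := hs (a i)
      rw [hfe, analyticOrderAt_mul (analyticAt_prod_one_sub_div s _) (hg.analyticAt _),
        analyticOrderAt_prod_one_sub_div ha, (hg.analyticAt _).analyticOrderAt_eq_zero.mpr hne,
        Finset.filter_insert, if_pos rfl, Finset.card_insert_of_notMem (by simp [hi]),
        add_zero] at h1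
      norm_cast at h1
      omega
    -- As g vanishes at `a i`, it equals (w - a) times its slope function; the factor -a turns w - a
    -- into 1 - w/a.
    refine ⟨fun w => -a i * dslope g (a i) w, ?_, fun w => ?_⟩
    · have := (differentiableOn_dslope (f := g) (c := a i) univ_mem).mpr hg.differentiableOn
      exact (differentiableOn_univ.mp this).const_mul _
    · have h2 := sub_smul_dslope g (a i) w
      rw [h0, sub_zero, smul_eq_mul] at h2
      rw [hfg, Finset.prod_insert hi, ← h2]
      field_simp [ha i]
      ring

/-- Orders add under multiplication, and the linear factors already account for the full order of f
at w. -/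
theorem ne_zero_of_eq_prod_mul [DecidableEq ι] {f g : ℂ → ℂ} (hg : Differentiable ℂ g) {a : ι → ℂ}
    (ha : ∀ i, a i ≠ 0) (s : Finset ι) (hfg : ∀ w, f w = (∏ i ∈ s, (1 - w / a i)) * g w) {w : ℂ}
    (hw : analyticOrderAt f w = ((s.filter (fun i => a i = w)).card : ℕ∞)) : g w ≠ 0 := by
  have hfe : f = (fun z : ℂ => ∏ j ∈ s, (1 - z / a j)) * g := funext hfg
  rw [hfe, analyticOrderAt_mul (analyticAt_prod_one_sub_div s _) (hg.analyticAt _),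
    analyticOrderAt_prod_one_sub_div ha] at hw
  refine (hg.analyticAt _).analyticOrderAt_eq_zero.mp ?_
  generalize analyticOrderAt g w = o at hw
  induction o using ENat.recTopCoe with
  | top => simp at hw
  | coe n => norm_cast at hw ⊢; omega

/-- Maximum principle: on |w| = 4R every factor with |a| ≤ R has modulus at least 4 - 1 = 3. The
gain 3^card serves to count zeros. -/
theorem norm_le_of_eq_prod_mul {f g : ℂ → ℂ} (hg : Differentiable ℂ g) {a : ι → ℂ}
    (ha : ∀ i, a i ≠ 0) (s : Finset ι) (hfg : ∀ w, f w = (∏ i ∈ s, (1 - w / a i)) * g w)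
    {R B : ℝ} (hR : 0 < R) (hB : ∀ w : ℂ, ‖w‖ = 4 * R → ‖f w‖ ≤ B) (hs : ∀ i ∈ s, ‖a i‖ ≤ R)
    {w : ℂ} (hw : ‖w‖ ≤ 4 * R) : 3 ^ s.card * ‖g w‖ ≤ B := by
  rw [← le_div_iff₀' (by positivity)]
  refine norm_le_of_forall_mem_frontier_norm_le (U := ball 0 (4 * R)) isBounded_ball
    hg.diffContOnCl (fun z hz => ?_) ?_
  · rw [frontier_ball _ (by positivity), mem_sphere_zero_iff_norm] at hz
    rw [le_div_iff₀' (by positivity)]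
    refine le_trans ?_ (hB z hz)
    rw [hfg, norm_mul, norm_prod, ← Finset.prod_const]
    gcongr with i hi
    have h1 : 4 ≤ ‖z / a i‖ := by
      rw [norm_div, hz, le_div_iff₀ (norm_pos_iff.mpr (ha i))]
      linarith [hs i hi]
    have h2 := norm_sub_norm_le (z / a i) 1
    rw [norm_sub_rev, norm_one] at h2
    linarith
  · rw [closure_ball _ (by positivity)]
    simpa using hw

theorem analyticAt_log_one_sub_div (a : ℂ) :
    AnalyticAt ℂ (fun w : ℂ => log (1 - w / a)) 0 := by
  have h : AnalyticAt ℂ (fun w : ℂ => 1 - w / a) 0 := by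
    simp only [div_eq_mul_inv]
    fun_prop
  exact h.clog (by simp)

theorem iteratedDeriv_log_one_sub_div {a : ℂ} (ha : a ≠ 0) (n : ℕ) :
    iteratedDeriv (n + 1) (fun w : ℂ => log (1 - w / a)) 0 = -(n.factorial : ℂ) / a ^ (n + 1) := by
  have hc : Continuous fun w : ℂ => 1 - w / a := by fun_prop
  have h1 : deriv (fun w : ℂ => log (1 - w / a)) =ᶠ[𝓝 0] fun w => (w - a)⁻¹ := by
    filter_upwards [hc.continuousAt.eventually_mem (isOpen_slitPlane.mem_nhds
      (by simp : 1 - (0 : ℂ) / a ∈ slitPlane))] with w hw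
    have h2 : HasDerivAt (fun z : ℂ => 1 - z / a) (-(1 / a)) w :=
      ((hasDerivAt_id w).div_const a).const_sub 1
    rw [(h2.clog hw).deriv]
    have h3 : 1 - w / a ≠ 0 := slitPlane_ne_zero hw
    have h4 : w - a ≠ 0 := by
      intro h
      rw [sub_eq_zero] at h
      simp [h, ha] at h3
    rw [one_sub_div ha] at h3 ⊢
    have h5 : a - w ≠ 0 := by rwa [← neg_sub, neg_ne_zero]
    field_simp
    ring
  rw [iteratedDeriv_succ', h1.iteratedDeriv_eq,
    iteratedDeriv_comp_sub_const n (fun w : ℂ => w⁻¹) a]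
  have h2 : iteratedDeriv n (fun w : ℂ => w⁻¹) (0 - a) =
      (-1) ^ n * n.factorial * (0 - a) ^ (-1 - n : ℤ) := by
    rw [iteratedDeriv_eq_iterate]; exact iter_deriv_inv n _
  simp only [h2]
  rw [zero_sub, show (-1 - n : ℤ) = -((n + 1 : ℕ) : ℤ) by push_cast; ring, zpow_neg, zpow_natCast,
    neg_pow a, pow_succ (-1 : ℂ)]
  rcases neg_one_pow_eq_or ℂ n with h | h <;> rw [h] <;> field_simp

/-- A zero-free holomorphic function on a disc has a logarithm; its Taylor coefficients at the
centre are controlled by an upper bound for the modulus. -/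
theorem exists_log_of_ne_zero {g : ℂ → ℂ} (hg : Differentiable ℂ g) {R M : ℝ} (hR : 0 < R)
    (hM : 0 < M) (h0 : g 0 = 1) (hne : ∀ w ∈ ball (0 : ℂ) R, g w ≠ 0)
    (hB : ∀ w ∈ ball (0 : ℂ) R, ‖g w‖ ≤ Real.exp M) :
    ∃ h : ℂ → ℂ, h 0 = 0 ∧ AnalyticAt ℂ h 0 ∧ (∀ w ∈ ball (0 : ℂ) R, exp (h w) = g w) ∧
      ∀ n, ‖iteratedDeriv n h 0‖ ≤ n.factorial * (2 * M) / (R / 2) ^ n := by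
  have hd : DifferentiableOn ℂ (fun w => deriv g w / g w) (ball 0 R) := fun w hw =>
    (((hg.analyticAt w).deriv.differentiableAt).div (hg w) (hne w hw)).differentiableWithinAt
  obtain ⟨h, hh0, hh⟩ := hd.isExactOn_ball.with_val_at 0 0
  have hhd : DifferentiableOn ℂ h (ball 0 R) := fun w hw =>
    (hh w hw).differentiableAt.differentiableWithinAt
  have hexp : ∀ w ∈ ball (0 : ℂ) R, exp (h w) = g w := by
    -- h is a primitive of g'/g, so g·exp(-h) is constant on the disc and equal to its value 1 at
    -- the centre.
    have hder : ∀ w ∈ ball (0 : ℂ) R, HasDerivAt (fun z => g z * exp (-h z)) 0 w := by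
      intro w hw
      refine ((hg w).hasDerivAt.mul (hh w hw).neg.cexp).congr_deriv ?_
      have := hne w hw
      field_simp
      ring
    intro w hw
    have := isOpen_ball.is_const_of_deriv_eq_zero (convex_ball (0 : ℂ) R).isPreconnected
      (fun z hz => (hder z hz).differentiableAt.differentiableWithinAt)
      (fun z hz => (hder z hz).deriv) hw (mem_ball_self hR)
    simp only [hh0, h0, neg_zero, exp_zero, mul_one] at this
    rw [exp_neg] at this
    field_simp at this
    exact this.symm
  have hre : Set.MapsTo h (ball 0 R) {z | z.re ≤ M} := by
    intro w hw
    have h1 := hB w hw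
    rw [← hexp w hw, norm_exp, Real.exp_le_exp] at h1
    exact h1
  refine ⟨h, hh0, hhd.analyticAt (ball_mem_nhds 0 hR), hexp, fun n => ?_⟩
  refine norm_iteratedDeriv_le_of_forall_mem_sphere_norm_le n (by positivity)
    ((hhd.mono ?_).diffContOnCl) fun z hz => ?_
  · rw [closure_ball _ (by positivity)]
    exact closedBall_subset_ball (by linarith)
  · rw [mem_sphere_zero_iff_norm] at hz
    have hzb : z ∈ ball (0 : ℂ) R := by rw [mem_ball_zero_iff]; linarith
    -- With Re h ≤ M on radius R, the bound on |z| = R/2 is 2M; Cauchy's estimate on that circle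
    -- does the rest.
    have h2 := borelCaratheodory_zero hM hhd hre hR hzb hh0
    rw [hz] at h2
    refine h2.trans (le_of_eq ?_)
    field_simp
    ring

theorem norm_iteratedDeriv_log_add_sum_le {f g : ℂ → ℂ} (hg : Differentiable ℂ g)
    {a : ι → ℂ} (ha : ∀ i, a i ≠ 0) (s : Finset ι)
    (hfg : ∀ w, f w = (∏ i ∈ s, (1 - w / a i)) * g w) {R M : ℝ} (hR : 0 < R)
    (hM : 0 < M) (h0 : g 0 = 1) (hne : ∀ w ∈ ball (0 : ℂ) R, g w ≠ 0)
    (hB : ∀ w ∈ ball (0 : ℂ) R, ‖g w‖ ≤ Real.exp M) (n : ℕ) :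
    ‖iteratedDeriv (n + 1) (fun w => log (f w)) 0 +
        ∑ i ∈ s, (n.factorial : ℂ) / a i ^ (n + 1)‖ ≤
      (n + 1).factorial * (2 * M) / (R / 2) ^ (n + 1) := by
  obtain ⟨h, hh0, hha, hexp, hbd⟩ := exists_log_of_ne_zero hg hR hM h0 hne hB
  have hsum : AnalyticAt ℂ (fun w => ∑ i ∈ s, log (1 - w / a i)) 0 :=
    Finset.analyticAt_fun_sum s fun i _ => analyticAt_log_one_sub_div (a i)
  have hu : AnalyticAt ℂ (fun w => h w + ∑ i ∈ s, log (1 - w / a i)) 0 := hha.add hsum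
  have heq : (fun w => log (f w)) =ᶠ[𝓝 0] fun w => h w + ∑ i ∈ s, log (1 - w / a i) := by
    -- Branch control: the right side is a logarithm of f that vanishes at 0, so close to 0 it is
    -- the principal one.
    have him : ∀ᶠ w in 𝓝 (0 : ℂ), (h w + ∑ i ∈ s, log (1 - w / a i)).im ∈
        Set.Ioo (-Real.pi) Real.pi := by
      refine (continuous_im.continuousAt.comp hu.continuousAt).eventually_mem ?_
      refine Ioo_mem_nhds ?_ ?_ <;> simp [hh0, Real.pi_pos]
    have hnz : ∀ᶠ w in 𝓝 (0 : ℂ), ∀ i ∈ s, 1 - w / a i ≠ 0 := by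
      rw [eventually_all_finset]
      intro i _
      have hc : Continuous fun w : ℂ => 1 - w / a i := by fun_prop
      exact hc.continuousAt.eventually_ne (by simp)
    filter_upwards [him, hnz, ball_mem_nhds (0 : ℂ) hR] with w hw1 hw2 hw3
    rw [← log_exp hw1.1 hw1.2.le, exp_add, exp_sum, hexp w hw3, hfg, mul_comm]
    congr 2
    exact Finset.prod_congr rfl fun i hi => (exp_log (hw2 i hi)).symm
  rw [heq.iteratedDeriv_eq]
  have hadd := iteratedDeriv_add (n := n + 1) (f := h)
    (g := fun w => ∑ i ∈ s, log (1 - w / a i)) hha.contDiffAt hsum.contDiffAt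
  have hs := iteratedDeriv_fun_sum (n := n + 1) (I := s) (x := (0 : ℂ))
    (f := fun i w => log (1 - w / a i)) fun i _ => (analyticAt_log_one_sub_div (a i)).contDiffAt
  have h3 : iteratedDeriv (n + 1) (fun w => h w + ∑ i ∈ s, log (1 - w / a i)) 0 =
      iteratedDeriv (n + 1) h 0 + ∑ i ∈ s, -(n.factorial : ℂ) / a i ^ (n + 1) := by
    rw [show (fun w => h w + ∑ i ∈ s, log (1 - w / a i)) =
      h + fun w => ∑ i ∈ s, log (1 - w / a i) from rfl, hadd, hs]
    simp only [iteratedDeriv_log_one_sub_div (ha _)]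
  rw [h3, add_assoc, ← Finset.sum_add_distrib]
  simp only [neg_div, neg_add_cancel, Finset.sum_const_zero, add_zero]
  exact hbd _

/-- A family of nonzero complex numbers whose counting function grows slower than linearly has an
absolutely summable family of inverses. -/
theorem summable_norm_inv_of_card_le {a : ι → ℂ} {δ K ρ : ℝ} (hδ : 0 < δ) (hK : 0 ≤ K)
    (hρ1 : ρ < 1) (ha : ∀ i, δ ≤ ‖a i‖)
    (hcard : ∀ R : ℝ, 1 ≤ R → ∀ s : Finset ι, (∀ i ∈ s, ‖a i‖ ≤ R) → (s.card : ℝ) ≤ K * R ^ ρ) :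
    Summable fun i => ‖a i‖⁻¹ := by
  classical
  -- Dyadic shells: 2^(k-1) < |a| ≤ 2^k on shell k ≥ 1, and |a| ≤ 1 on shell 0. In the constant c,
  -- the 2 serves the shells k ≥ 1 and 1/δ serves shell 0. Shell k has at most K·2^(kρ) members, so
  -- the sum is dominated by a geometric series of ratio 2^(ρ-1).
  set κ : ι → ℕ := fun i => Nat.clog 2 ⌈‖a i‖⌉₊ with hκ
  set c : ℝ := max 2 (1 / δ) with hc
  have hc0 : 0 ≤ c := le_trans (by norm_num) (le_max_left _ _)
  have hle : ∀ i, ‖a i‖ ≤ 2 ^ κ i := fun i => by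
    refine (Nat.le_ceil _).trans ?_
    exact_mod_cast Nat.le_pow_clog (by norm_num) _
  have hinv : ∀ i, ‖a i‖⁻¹ ≤ c * (1 / 2) ^ κ i := fun i => by
    have hpos : 0 < ‖a i‖ := hδ.trans_le (ha i)
    rcases Nat.eq_zero_or_pos (κ i) with h | h
    · rw [h, pow_zero, mul_one]
      refine le_trans ?_ (le_max_right _ _)
      rw [one_div]
      exact inv_anti₀ hδ (ha i)
    · obtain ⟨k, hk⟩ : ∃ k, κ i = k + 1 := ⟨κ i - 1, by omega⟩
      have h1 : 2 ^ k < ⌈‖a i‖⌉₊ := by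
        by_contra hcon
        have h2 := (Nat.clog_le_iff_le_pow (b := 2) (by norm_num)).mpr (not_lt.mp hcon)
        have h3 : κ i ≤ k := h2
        omega
      have h2 : (2 : ℝ) ^ k < ‖a i‖ := by exact_mod_cast Nat.lt_ceil.mp h1
      calc ‖a i‖⁻¹ ≤ ((2 : ℝ) ^ k)⁻¹ := inv_anti₀ (by positivity) h2.le
        _ = 2 * (1 / 2) ^ κ i := by rw [hk, pow_succ, one_div, inv_pow]; ring
        _ ≤ c * (1 / 2) ^ κ i := by gcongr; exact le_max_left _ _
  have hq0 : (0 : ℝ) ≤ 2 ^ (ρ - 1) := by positivity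
  have hq1 : (2 : ℝ) ^ (ρ - 1) < 1 := Real.rpow_lt_one_of_one_lt_of_neg (by norm_num) (by linarith)
  have hgeo := summable_geometric_of_lt_one hq0 hq1
  refine summable_of_sum_le (c := K * c * ∑' k : ℕ, ((2 : ℝ) ^ (ρ - 1)) ^ k)
    (fun i => by positivity) fun s => ?_
  calc ∑ i ∈ s, ‖a i‖⁻¹ ≤ ∑ i ∈ s, c * (1 / 2) ^ κ i := Finset.sum_le_sum fun i _ => hinv i
    _ = ∑ k ∈ s.image κ, (s.filter (fun i => κ i = k)).card • (c * (1 / 2) ^ k) :=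
        Finset.sum_comp (fun k : ℕ => c * (1 / 2 : ℝ) ^ k) κ
    _ ≤ ∑ k ∈ s.image κ, K * c * ((2 : ℝ) ^ (ρ - 1)) ^ k := by
        refine Finset.sum_le_sum fun k _ => ?_
        have h1 := hcard (2 ^ k) (one_le_pow₀ (by norm_num)) (s.filter fun i => κ i = k)
          fun i hi => (Finset.mem_filter.mp hi).2 ▸ hle i
        rw [nsmul_eq_mul]
        have h2 : ((2 : ℝ) ^ (ρ - 1)) ^ k = ((2 : ℝ) ^ k) ^ ρ * (1 / 2) ^ k := by
          rw [Real.rpow_sub_one (by norm_num), ← Real.rpow_natCast_mul (by norm_num),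
            mul_comm (k : ℝ), Real.rpow_mul_natCast (by norm_num), div_pow, one_div, inv_pow,
            div_eq_mul_inv]
        rw [h2]
        calc _ ≤ K * ((2 : ℝ) ^ k) ^ ρ * (c * (1 / 2) ^ k) := by gcongr
          _ = _ := by ring
    _ = K * c * ∑ k ∈ s.image κ, ((2 : ℝ) ^ (ρ - 1)) ^ k := by rw [Finset.mul_sum]
    _ ≤ _ := by
        gcongr
        exact hgeo.sum_le_tsum _ fun k _ => by positivity

/-- `a` lists the zeros of the entire function `f` with their multiplicities, `f 0 = 1`, and
`f` grows at most like `exp (C + |w| ^ ρ)` with `0 < ρ < 1`. -/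
structure ZeroFamily (f : ℂ → ℂ) (a : ι → ℂ) (C ρ : ℝ) : Prop where
  differentiable : Differentiable ℂ f
  map_zero : f 0 = 1
  encard_eq : ∀ w, {i | a i = w}.encard = analyticOrderAt f w
  rho_pos : 0 < ρ
  rho_lt_one : ρ < 1
  norm_le : ∀ w, ‖f w‖ ≤ Real.exp (C + ‖w‖ ^ ρ)

namespace ZeroFamily

variable {f : ℂ → ℂ} {a : ι → ℂ} {C ρ : ℝ}

theorem map_eq_zero (H : ZeroFamily f a C ρ) (i : ι) : f (a i) = 0 := by
  refine apply_eq_zero_of_analyticOrderAt_ne_zero ?_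
  rw [← H.encard_eq, Set.encard_ne_zero]
  exact ⟨i, rfl⟩

theorem ne_zero (H : ZeroFamily f a C ρ) (i : ι) : a i ≠ 0 := fun h => by
  have := H.map_eq_zero i
  rw [h, H.map_zero] at this
  exact one_ne_zero this

theorem C_nonneg (H : ZeroFamily f a C ρ) : 0 ≤ C := by
  have h := H.norm_le 0
  rw [H.map_zero, norm_zero, Real.zero_rpow H.rho_pos.ne', add_zero, norm_one,
    Real.one_le_exp_iff] at h
  exact h

theorem card_filter_le [DecidableEq ι] (H : ZeroFamily f a C ρ) (s : Finset ι) (w : ℂ) :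
    ((s.filter (fun i => a i = w)).card : ℕ∞) ≤ analyticOrderAt f w := by
  rw [← H.encard_eq, ← Set.encard_coe_eq_coe_finsetCard]
  exact Set.encard_le_encard fun i hi => by simpa using (Finset.mem_filter.mp hi).2

theorem norm_le_exp (H : ZeroFamily f a C ρ) {g : ℂ → ℂ} (hg : Differentiable ℂ g) {s : Finset ι}
    (hfg : ∀ w, f w = (∏ i ∈ s, (1 - w / a i)) * g w) {R : ℝ} (hR : 0 < R)
    (hs : ∀ i ∈ s, ‖a i‖ ≤ R) {w : ℂ} (hw : ‖w‖ ≤ 4 * R) :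
    3 ^ s.card * ‖g w‖ ≤ Real.exp (C + (4 * R) ^ ρ) :=
  norm_le_of_eq_prod_mul hg H.ne_zero s hfg hR (fun z hz => hz ▸ H.norm_le z) hs hw

theorem eval_zero_eq_one (H : ZeroFamily f a C ρ) {g : ℂ → ℂ} {s : Finset ι}
    (hfg : ∀ w, f w = (∏ i ∈ s, (1 - w / a i)) * g w) : g 0 = 1 := by
  have := hfg 0
  simpa [H.map_zero] using this.symm

/-- A Jensen-type count: the quotient by the linear factors is 1 at the origin, so 3^card ≤ exp(C +
(4R)^ρ), and e < 3. -/
theorem card_le (H : ZeroFamily f a C ρ) {R : ℝ} (hR : 0 < R) (s : Finset ι)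
    (hs : ∀ i ∈ s, ‖a i‖ ≤ R) : (s.card : ℝ) ≤ C + (4 * R) ^ ρ := by
  classical
  obtain ⟨g, hg, hfg⟩ := exists_eq_prod_mul H.differentiable H.ne_zero s (H.card_filter_le s)
  have h1 := H.norm_le_exp hg hfg hR hs (w := 0) (by simp [hR.le])
  rw [H.eval_zero_eq_one hfg, norm_one, mul_one] at h1
  rw [← Real.exp_le_exp]
  refine le_trans ?_ h1
  rw [← mul_one (s.card : ℝ), Real.exp_nat_mul]
  gcongr
  exact Real.exp_one_lt_three.le

theorem finite_norm_le (H : ZeroFamily f a C ρ) {R : ℝ} (hR : 0 < R) :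
    {i | ‖a i‖ ≤ R}.Finite := by
  by_contra hinf
  obtain ⟨n, hn⟩ := exists_nat_gt (C + (4 * R) ^ ρ)
  obtain ⟨t, ht, htc⟩ := Set.Infinite.exists_subset_card_eq hinf n
  have := H.card_le hR t fun i hi => ht hi
  rw [htc] at this
  linarith

theorem summable_norm_inv (H : ZeroFamily f a C ρ) : Summable fun i => ‖a i‖⁻¹ := by
  obtain ⟨δ, hδ, hδf⟩ : ∃ δ > 0, ∀ i, δ ≤ ‖a i‖ := by
    have h1 : ∀ᶠ w in 𝓝 (0 : ℂ), f w ≠ 0 :=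
      H.differentiable.continuous.continuousAt.eventually_ne (by rw [H.map_zero]; exact one_ne_zero)
    obtain ⟨δ, hδ, h2⟩ := Metric.eventually_nhds_iff.mp h1
    refine ⟨δ, hδ, fun i => ?_⟩
    by_contra hcon
    exact h2 (by simpa using hcon) (H.map_eq_zero i)
  refine summable_norm_inv_of_card_le (K := C + 4 ^ ρ) (ρ := ρ) hδ
    (add_nonneg H.C_nonneg (by positivity)) H.rho_lt_one hδf fun R hR s hs => ?_
  refine (H.card_le (by linarith) s hs).trans ?_
  rw [Real.mul_rpow (by norm_num) (by linarith), add_mul]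
  gcongr
  exact le_mul_of_one_le_right H.C_nonneg (Real.one_le_rpow hR H.rho_pos.le)

theorem summable_pow (H : ZeroFamily f a C ρ) (n : ℕ) : Summable fun i => 1 / a i ^ (n + 1) := by
  obtain ⟨δ, hδ⟩ := H.summable_norm_inv.tendsto_cofinite_zero.isBoundedUnder_le.eventually_le
  refine Summable.of_norm_bounded_eventually (g := fun i => δ ^ n * ‖a i‖⁻¹)
    (H.summable_norm_inv.mul_left _) ?_
  filter_upwards [hδ] with i hi
  rw [norm_div, norm_one, norm_pow, one_div, ← inv_pow, pow_succ]
  gcongr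

/-- The error left after dividing out the zeros of modulus at most R = N + 1. It is of size
R^(ρ-n-1) plus R^(-n-1); the exponents are negative already for n = 0 because ρ < 1. -/
theorem tendsto_bound (C : ℝ) {ρ : ℝ} (hρ1 : ρ < 1) (n : ℕ) :
    Tendsto (fun N : ℕ => ((n + 1).factorial : ℝ) * (2 * (C + (4 * ((N : ℝ) + 1)) ^ ρ)) /
      (((N : ℝ) + 1) / 2) ^ (n + 1)) atTop (𝓝 0) := by
  have hx : Tendsto (fun N : ℕ => (N : ℝ) + 1) atTop atTop :=
    tendsto_atTop_add_const_right _ _ tendsto_natCast_atTop_atTop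
  have h1 : Tendsto (fun x : ℝ => C * x ^ (-((n : ℝ) + 1)) + 4 ^ ρ * x ^ (-((n : ℝ) + 1 - ρ)))
      atTop (𝓝 (C * 0 + 4 ^ ρ * 0)) :=
    ((tendsto_rpow_neg_atTop (by positivity)).const_mul _).add
      ((tendsto_rpow_neg_atTop (by linarith [n.cast_nonneg (α := ℝ)])).const_mul _)
  have h2 := (h1.const_mul (((n + 1).factorial : ℝ) * 2 * 2 ^ (n + 1))).comp hx
  simp only [mul_zero, add_zero] at h2
  refine h2.congr fun N => ?_
  have hpos : (0 : ℝ) < (N : ℝ) + 1 := by positivity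
  simp only [Function.comp_apply]
  rw [neg_sub, Real.rpow_sub hpos, Real.rpow_neg hpos.le,
    Real.mul_rpow (by norm_num) hpos.le, show (n : ℝ) + 1 = ((n + 1 : ℕ) : ℝ) by push_cast; ring,
    Real.rpow_natCast, div_pow]
  field_simp

/-- The Taylor coefficients of `log f` at the origin are the power sums of the inverse zeros. -/
theorem tsum_eq (H : ZeroFamily f a C ρ) (n : ℕ) :
    (n.factorial : ℂ) * ∑' i, 1 / a i ^ (n + 1) =
      -iteratedDeriv (n + 1) (fun w => log (f w)) 0 := by
  classical
  set s : ℕ → Finset ι := fun N =>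
    (H.finite_norm_le (R := (N : ℝ) + 1) (by positivity)).toFinset with hs
  have hsmem : ∀ N i, i ∈ s N ↔ ‖a i‖ ≤ (N : ℝ) + 1 := fun N i => by simp [hs]
  have hs_atTop : Tendsto s atTop atTop := by
    refine tendsto_atTop_finset_of_monotone (fun N M hNM i hi => ?_) fun i => ?_
    · rw [hsmem] at hi ⊢
      have : (N : ℝ) ≤ M := by exact_mod_cast hNM
      linarith
    · obtain ⟨N, hN⟩ := exists_nat_ge ‖a i‖
      exact ⟨N, (hsmem _ _).mpr (by linarith)⟩
  have h1 : Tendsto (fun N => iteratedDeriv (n + 1) (fun w => log (f w)) 0 +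
      ∑ i ∈ s N, (n.factorial : ℂ) / a i ^ (n + 1)) atTop (𝓝 0) := by
    refine squeeze_zero_norm (fun N => ?_) (tendsto_bound C H.rho_lt_one n)
    have hR : (0 : ℝ) < (N : ℝ) + 1 := by positivity
    obtain ⟨g, hg, hfg⟩ :=
      exists_eq_prod_mul H.differentiable H.ne_zero (s N) (H.card_filter_le (s N))
    refine norm_iteratedDeriv_log_add_sum_le hg H.ne_zero (s N) hfg hR
      (add_pos_of_nonneg_of_pos H.C_nonneg (by positivity)) (H.eval_zero_eq_one hfg)
      (fun w hw => ?_) (fun w hw => ?_) n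
    · refine ne_zero_of_eq_prod_mul hg H.ne_zero (s N) hfg ?_
      rw [← H.encard_eq, ← Set.encard_coe_eq_coe_finsetCard]
      congr 1
      ext i
      simp only [Finset.coe_filter, hsmem, Set.mem_ofPred_eq]
      refine ⟨fun h => ⟨?_, h⟩, fun h => h.2⟩
      rw [h]
      exact (mem_ball_zero_iff.mp hw).le
    · have h2 := H.norm_le_exp hg hfg hR (fun i hi => (hsmem N i).mp hi) (w := w)
        (by linarith [mem_ball_zero_iff.mp hw])
      refine le_trans ?_ h2
      exact le_mul_of_one_le_left (norm_nonneg _) (one_le_pow₀ (by norm_num))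
  have h2 : Tendsto (fun N => iteratedDeriv (n + 1) (fun w => log (f w)) 0 +
      ∑ i ∈ s N, (n.factorial : ℂ) / a i ^ (n + 1)) atTop
      (𝓝 (iteratedDeriv (n + 1) (fun w => log (f w)) 0 +
        (n.factorial : ℂ) * ∑' i, 1 / a i ^ (n + 1))) := by
    have h3 := ((H.summable_pow n).hasSum.mul_left (n.factorial : ℂ)).comp hs_atTop
    refine (h3.const_add _).congr fun N => ?_
    simp [div_eq_mul_inv]
  have h3 := tendsto_nhds_unique h1 h2
  linear_combination -h3

/-- An entire function of order less than one with finitely many zeros has only finitely many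
nonzero Taylor coefficients at the origin. -/
theorem iteratedDeriv_eq_zero_of_card_lt [Fintype ι] (H : ZeroFamily f a C ρ) {k : ℕ}
    (hk : Fintype.card ι < k) : iteratedDeriv k f 0 = 0 := by
  have hfa : AnalyticAt ℂ (fun w => log (f w)) 0 :=
    (H.differentiable.analyticAt 0).clog (by simp [H.map_zero])
  have hsum : AnalyticAt ℂ (fun w => ∑ i, log (1 - w / a i)) 0 :=
    Finset.analyticAt_fun_sum _ fun i _ => analyticAt_log_one_sub_div (a i)
  -- Both logarithms have the same Taylor coefficients, by `tsum_eq`, so they agree near 0;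
  -- exponentiating makes f agree there with a polynomial of degree at most the number of zeros.
  have hcoef : ∀ n, iteratedDeriv n (fun w => log (f w)) 0 =
      iteratedDeriv n (fun w => ∑ i, log (1 - w / a i)) 0 := by
    rintro (_ | n)
    · simp [H.map_zero]
    · have h1 := H.tsum_eq n
      rw [iteratedDeriv_fun_sum (n := n + 1) (I := Finset.univ) (x := (0 : ℂ))
        (f := fun i w => log (1 - w / a i))
        fun i _ => (analyticAt_log_one_sub_div (a i)).contDiffAt]
      simp only [iteratedDeriv_log_one_sub_div (H.ne_zero _)]
      rw [tsum_fintype, Finset.mul_sum] at h1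
      rw [← neg_eq_iff_eq_neg.mpr h1, ← Finset.sum_neg_distrib]
      exact Finset.sum_congr rfl fun i _ => by ring
  have heq : (fun w => log (f w)) =ᶠ[𝓝 0] fun w => ∑ i, log (1 - w / a i) := by
    have h1 := hfa.hasFPowerSeriesAt
    simp only [hcoef] at h1
    filter_upwards [h1.eventually_hasSum_sub, hsum.hasFPowerSeriesAt.eventually_hasSum_sub]
      with w hw1 hw2
    exact hw1.unique hw2
  have hprod : f =ᶠ[𝓝 0] fun w => ∏ i, (1 - w / a i) := by
    have hnz : ∀ᶠ w in 𝓝 (0 : ℂ), ∀ i, 1 - w / a i ≠ 0 := by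
      rw [eventually_all]
      intro i
      have hc : Continuous fun w : ℂ => 1 - w / a i := by fun_prop
      exact hc.continuousAt.eventually_ne (by simp)
    filter_upwards [heq, hnz, H.differentiable.continuous.continuousAt.eventually_ne
      (by rw [H.map_zero]; exact one_ne_zero)] with w h1 h2 h3
    rw [← exp_log h3, h1, exp_sum]
    exact Finset.prod_congr rfl fun i _ => exp_log (h2 i)
  rw [hprod.iteratedDeriv_eq]
  set P : Polynomial ℂ := ∏ i, (1 - Polynomial.C (a i)⁻¹ * Polynomial.X) with hP
  have hPe : (fun w => ∏ i, (1 - w / a i)) = fun w => P.eval w := by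
    ext w
    rw [hP, Polynomial.eval_prod]
    refine Finset.prod_congr rfl fun i _ => ?_
    simp only [Polynomial.eval_sub, Polynomial.eval_one, Polynomial.eval_mul, Polynomial.eval_C,
      Polynomial.eval_X]
    ring
  have hdeg : P.natDegree < k := by
    refine lt_of_le_of_lt (Polynomial.natDegree_prod_le _ _) (lt_of_le_of_lt ?_ hk)
    refine (Finset.sum_le_card_nsmul _ _ 1 fun i _ => ?_).trans (by simp)
    compute_degree
  rw [hPe, iteratedDeriv_eq_iterate]
  have hit : ∀ (j : ℕ) (Q : Polynomial ℂ), deriv^[j] (fun w => Q.eval w) =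
      fun w => (Polynomial.derivative^[j] Q).eval w := by
    intro j
    induction j with
    | zero => intro Q; rfl
    | succ j ih =>
      intro Q
      rw [Function.iterate_succ_apply, Function.iterate_succ_apply, ← ih]
      congr 1
      ext w
      exact Q.deriv
  rw [hit, Polynomial.iterate_derivative_eq_zero hdeg]
  simp

end ZeroFamily

end EntirePowerSum

/-! ### Newton's recurrence and its explicit solution. -/

namespace NewtonSeries

open Filter Topology Finset

/-- The Taylor coefficients of `f` at the origin and those of `log f` are related by Newton's
recurrence. -/
theorem iteratedDeriv_log_recurrence {f : ℂ → ℂ} (hf : AnalyticAt ℂ f 0) (h0 : f 0 = 1) (k : ℕ) :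
    iteratedDeriv (k + 1) f 0 / (k.factorial : ℂ) = ∑ i ∈ range (k + 1),
      iteratedDeriv (i + 1) (fun w => Complex.log (f w)) 0 / (i.factorial : ℂ) *
        (iteratedDeriv (k - i) f 0 / ((k - i).factorial : ℂ)) := by
  have hlog : AnalyticAt ℂ (fun w => Complex.log (f w)) 0 := hf.clog (by simp [h0])
  -- The recurrence is the Leibniz rule applied to f' = (log f)' f.
  have heq : deriv f =ᶠ[𝓝 0] deriv (fun w => Complex.log (f w)) * f := by
    have h1 : ∀ᶠ w in 𝓝 (0 : ℂ), f w ∈ Complex.slitPlane :=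
      hf.continuousAt.eventually_mem (Complex.isOpen_slitPlane.mem_nhds (by simp [h0]))
    filter_upwards [h1, hf.eventually_analyticAt] with w hw1 hw2
    rw [Pi.mul_apply, (hw2.differentiableAt.hasDerivAt.clog hw1).deriv]
    field_simp [Complex.slitPlane_ne_zero hw1]
  rw [iteratedDeriv_succ', heq.iteratedDeriv_eq,
    iteratedDeriv_mul hlog.deriv.contDiffAt hf.contDiffAt, sum_div]
  refine sum_congr rfl fun i hi => ?_
  rw [iteratedDeriv_succ', Nat.cast_choose ℂ (Nat.lt_succ_iff.mp (mem_range.mp hi))]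
  have h1 := Nat.cast_ne_zero (R := ℂ).mpr (Nat.factorial_ne_zero k)
  field_simp

open PowerSeries in
-- Multinomial theorem: the term of a tuple r is a multiple of X^(Σ (i+1) r_i), so only tuples of
-- weight k reach the coefficient of X^k.
theorem coeff_sum_X_pow_pow {R : Type*} [CommSemiring R] (x : ℕ → R) (k j : ℕ) :
    coeff k ((∑ i : Fin k, C (x ((i : ℕ) + 1)) * (X : R⟦X⟧) ^ ((i : ℕ) + 1)) ^ j) =
      ∑ r ∈ RealCharXi.weightedTuples k with ∑ i, r i = j,
        (Nat.multinomial univ r : R) * ∏ i : Fin k, x ((i : ℕ) + 1) ^ r i := by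
  rw [sum_pow_eq_sum_piAntidiag, map_sum]
  have hterm : ∀ r : Fin k → ℕ,
      coeff k ((Nat.multinomial univ r : R⟦X⟧) *
        ∏ i : Fin k, (C (x ((i : ℕ) + 1)) * (X : R⟦X⟧) ^ ((i : ℕ) + 1)) ^ r i) =
      if ∑ i : Fin k, ((i : ℕ) + 1) * r i = k then
        (Nat.multinomial univ r : R) * ∏ i : Fin k, x ((i : ℕ) + 1) ^ r i else 0 := by
    intro r
    have : (Nat.multinomial univ r : R⟦X⟧) *
        ∏ i : Fin k, (C (x ((i : ℕ) + 1)) * (X : R⟦X⟧) ^ ((i : ℕ) + 1)) ^ r i =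
        C ((Nat.multinomial univ r : R) * ∏ i : Fin k, x ((i : ℕ) + 1) ^ r i) *
          (X : R⟦X⟧) ^ (∑ i : Fin k, ((i : ℕ) + 1) * r i) := by
      simp only [mul_pow, prod_mul_distrib, map_mul, map_natCast, map_prod, map_pow, ← pow_mul,
        prod_pow_eq_pow_sum, mul_assoc]
    rw [this, coeff_C_mul, coeff_X_pow]
    simp only [eq_comm (a := k), mul_ite, mul_one, mul_zero]
  rw [sum_congr rfl fun r _ => hterm r, ← sum_filter]
  refine sum_congr ?_ fun _ _ => rfl
  ext r
  simp [RealCharXi.mem_weightedTuples, and_comm]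

open PowerSeries in
/-- The solution of Newton's recurrence as an explicit sum over weighted tuples. -/
theorem eq_sum_weightedTuples {K : Type*} [Field K] [CharZero K] {x S : ℕ → K}
    (h : ∀ k, S (k + 1) = (k + 1) * x (k + 1) + ∑ i ∈ range k, S (i + 1) * x (k - i))
    {k : ℕ} (hk : 1 ≤ k) :
    S k = ∑ r ∈ RealCharXi.weightedTuples k,
      (k : K) * (Nat.factorial ((∑ i, r i) - 1) : K) / (∏ i, (Nat.factorial (r i) : K)) *
        ∏ i : Fin k, x ((i : ℕ) + 1) ^ r i := by
  set F : K⟦X⟧ := mk fun n => if n = 0 then 0 else x n with hF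
  set T : K⟦X⟧ := mk fun n => if n = 0 then 0 else S n with hT
  set G : K⟦X⟧ := ∑ i : Fin k, C (x ((i : ℕ) + 1)) * (X : K⟦X⟧) ^ ((i : ℕ) + 1) with hG
  -- The recurrence in generating series: T(1 - F) = X F'. Both series have constant term 0 whatever
  -- `x 0` and `S 0` are.
  have hrec : T = X * derivative K F + T * F := by
    ext n
    rcases n with _ | n
    · simp [hT]
    · rw [map_add, coeff_succ_X_mul, coeff_derivative, coeff_mul,
        Nat.sum_antidiagonal_eq_sum_range_succ_mk, sum_range_succ, sum_range_succ']
      simp only [hT, hF, coeff_mk]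
      rw [if_neg n.succ_ne_zero, if_neg n.succ_ne_zero, h n]
      simp only [Nat.succ_ne_zero, if_false, if_true, Nat.sub_self, mul_zero, zero_mul, add_zero,
        Nat.add_sub_add_right]
      congr 1
      · ring
      · refine sum_congr rfl fun i hi => ?_
        rw [if_neg]
        have := mem_range.mp hi
        omega
  have hXF : (X : K⟦X⟧) ∣ F := X_dvd_iff.mpr (by simp [hF])
  -- A finite geometric expansion of X F'/(1 - F); the remainder T F^k is divisible by X^(k+1) and
  -- does not affect coefficient k.
  have hsum : T = T * F ^ k + ∑ j ∈ range k, X * derivative K F * F ^ j := by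
    have h1 : X * derivative K F = T * (1 - F) := by linear_combination -hrec
    rw [← mul_sum, h1, mul_assoc, mul_neg_geom_sum]
    ring
  -- Up to degree k the series F may be replaced by the polynomial G, whose powers the multinomial
  -- theorem expands.
  have hFG : (X : K⟦X⟧) ^ (k + 1) ∣ F - G := by
    rw [X_pow_dvd_iff]
    intro n hn
    rw [map_sub, hG, map_sum, sub_eq_zero]
    simp only [coeff_C_mul, coeff_X_pow, mul_ite, mul_one, mul_zero]
    rcases n with _ | n
    · simp [hF]
    · rw [sum_eq_single (⟨n, by omega⟩ : Fin k)]
      · simp [hF]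
      · intro i _ hi
        rw [if_neg]
        intro h1
        exact hi (Fin.ext (by simpa using h1.symm))
      · simp
  have hpow : ∀ j, coeff k (F ^ j) = coeff k (G ^ j) := fun j => by
    have := X_pow_dvd_iff.mp (hFG.trans (sub_dvd_pow_sub_pow F G j)) k (by omega)
    rwa [map_sub, sub_eq_zero] at this
  have hTk : coeff k (T * F ^ k) = 0 := by
    have h1 : (X : K⟦X⟧) ^ (k + 1) ∣ T * F ^ k := by
      rw [pow_succ']
      exact mul_dvd_mul (X_dvd_iff.mpr (by simp [hT])) (pow_dvd_pow_of_dvd hXF k)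
    exact X_pow_dvd_iff.mp h1 k (by omega)
  -- F' F^j = (F^(j+1))'/(j+1), and X d/dX multiplies coefficient k by k.
  have hder : ∀ j : ℕ, coeff k (X * derivative K F * F ^ j) =
      (k : K) / ((j : K) + 1) * coeff k (G ^ (j + 1)) := by
    intro j
    have hj : (j : K) + 1 ≠ 0 := by exact_mod_cast j.succ_ne_zero
    have h1 : ((j : K) + 1) * coeff k (X * derivative K F * F ^ j) =
        coeff k (X * derivative K (F ^ (j + 1))) := by
      rw [derivative_pow, ← coeff_C_mul]
      congr 1
      simp
      ring
    have h2 : coeff k (X * derivative K (F ^ (j + 1))) = k * coeff k (F ^ (j + 1)) := by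
      obtain ⟨l, rfl⟩ : ∃ l, k = l + 1 := ⟨k - 1, by omega⟩
      rw [coeff_succ_X_mul, coeff_derivative]
      push_cast
      ring
    rw [← hpow]
    field_simp
    rw [← h2, ← h1, mul_comm]
  have hS : S k = coeff k T := by simp [hT, show k ≠ 0 by omega]
  rw [hS, hsum, map_add, hTk, zero_add, map_sum, sum_congr rfl fun j _ => hder j]
  have hmaps : ∀ r ∈ RealCharXi.weightedTuples k, (∑ i, r i) - 1 ∈ range k := by
    intro r hr
    rw [RealCharXi.mem_weightedTuples] at hr
    have : ∑ i, r i ≤ ∑ i : Fin k, ((i : ℕ) + 1) * r i :=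
      sum_le_sum fun i _ => Nat.le_mul_of_pos_left _ (by omega)
    rw [mem_range]
    omega
  rw [← sum_fiberwise_of_maps_to hmaps]
  refine sum_congr rfl fun j _ => ?_
  rw [hG, coeff_sum_X_pow_pow, mul_sum]
  have hset : (RealCharXi.weightedTuples k).filter (fun r => ∑ i, r i = j + 1) =
      (RealCharXi.weightedTuples k).filter (fun r => (∑ i, r i) - 1 = j) := by
    refine filter_congr fun r hr => ?_
    rw [RealCharXi.mem_weightedTuples] at hr
    have : ∑ i, r i ≠ 0 := by
      intro h0
      rw [sum_eq_zero_iff] at h0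
      have : ∑ i : Fin k, ((i : ℕ) + 1) * r i = 0 := sum_eq_zero fun i hi => by rw [h0 i hi, mul_zero]
      omega
    omega
  rw [hset]
  refine sum_congr rfl fun r hr => ?_
  rw [← hset] at hr
  have hrs := (mem_filter.mp hr).2
  have hmul := Nat.multinomial_spec (univ : Finset (Fin k)) r
  have hmul' : (∏ i, (Nat.factorial (r i) : K)) * (Nat.multinomial univ r : K) =
      ((j : K) + 1) * (Nat.factorial j : K) := by
    rw [hrs, Nat.factorial_succ] at hmul
    exact_mod_cast hmul
  have hj : (j : K) + 1 ≠ 0 := by exact_mod_cast j.succ_ne_zero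
  have hp : (∏ i, (Nat.factorial (r i) : K)) ≠ 0 :=
    prod_ne_zero_iff.mpr fun i _ => by exact_mod_cast Nat.factorial_ne_zero _
  rw [hrs, Nat.add_sub_cancel, ← mul_assoc]
  congr 1
  field_simp
  linear_combination (k : K) * hmul'

end NewtonSeries

/-! ### Positive functionals on polynomials via Bernstein expansion. -/

namespace HausdorffMoment

open Filter Topology Finset Polynomial

/-- Multiply the partition of unity of degree n - d by X^d: each product is a multiple of a
Bernstein polynomial of degree n, and terms with k < d carry coefficient 0. -/
theorem X_pow_eq_sum_bernsteinPolynomial {d n : ℕ} (hd : d ≤ n) :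
    (X : ℝ[X]) ^ d = ∑ k ∈ range (n + 1),
      ((k.choose d : ℝ) / n.choose d) • bernsteinPolynomial ℝ n k := by
  have hc : (n.choose d : ℝ) ≠ 0 := by exact_mod_cast (Nat.choose_pos hd).ne'
  obtain ⟨e, rfl⟩ := Nat.exists_eq_add_of_le hd
  rw [show d + e + 1 = d + (e + 1) by ring, sum_range_add,
    sum_eq_zero (s := range d) fun k hk => by
      rw [Nat.choose_eq_zero_of_lt (mem_range.mp hk)]; simp, zero_add]
  have h1 : ∀ k ∈ range (e + 1), (((d + k).choose d : ℝ) / (d + e).choose d) •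
      bernsteinPolynomial ℝ (d + e) (d + k) = X ^ d * bernsteinPolynomial ℝ e k := by
    intro k hk
    have hke : k ≤ e := Nat.lt_succ_iff.mp (mem_range.mp hk)
    have h2 := Nat.choose_mul (n := d + e) (k := d + k) (s := d) (by omega)
    rw [Nat.add_sub_cancel_left, Nat.add_sub_cancel_left] at h2
    have h3 : ((d + k).choose d : ℝ) / (d + e).choose d * (d + e).choose (d + k) = e.choose k := by
      field_simp
      have h4 : ((d + e).choose (d + k) : ℝ) * (d + k).choose d =
        (d + e).choose d * e.choose k := by exact_mod_cast h2
      linear_combination h4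
    rw [bernsteinPolynomial, bernsteinPolynomial, smul_eq_C_mul, ← C_eq_natCast (R := ℝ),
      ← C_eq_natCast (R := ℝ), ← h3, map_mul, pow_add, show d + e - (d + k) = e - k by omega]
    ring
  rw [sum_congr rfl h1, ← mul_sum, bernsteinPolynomial.sum, mul_one]

/-- The Bernstein coefficients of X^d are nearly its values at k/n. Passing from d to d + 1
multiplies the ratio by (k-d)/(n-d) in place of k/n, an error of at most d/(n-d); for k < d the
binomials vanish and the power only decreases. -/
theorem abs_choose_div_sub_pow_le {d n k : ℕ} (hd : d < n) (hk : k ≤ n) :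
    |(k.choose d : ℝ) / n.choose d - ((k : ℝ) / n) ^ d| ≤ d * d / ((n : ℝ) - d) := by
  have hn : (0 : ℝ) < n := by exact_mod_cast (Nat.zero_le d).trans_lt hd
  have hkn : (k : ℝ) / n ≤ 1 := div_le_one_of_le₀ (by exact_mod_cast hk) hn.le
  have hkn0 : (0 : ℝ) ≤ (k : ℝ) / n := by positivity
  induction d with
  | zero => simp
  | succ d ih =>
    have ih := ih (by omega)
    have hdn : (d : ℝ) + 1 < n := by exact_mod_cast hd
    have hc : (0 : ℝ) < n.choose d := by exact_mod_cast Nat.choose_pos (by omega : d ≤ n)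
    have hc1 : (0 : ℝ) < n.choose (d + 1) := by exact_mod_cast Nat.choose_pos hd.le
    have hd0 : (0 : ℝ) ≤ d := d.cast_nonneg
    have hstep : |(k.choose (d + 1) : ℝ) / n.choose (d + 1) - ((k : ℝ) / n) ^ (d + 1)| ≤
        d * d / ((n : ℝ) - d) + d / ((n : ℝ) - d) := by
      rcases lt_or_ge k d with hkd | hkd
      · rw [Nat.choose_eq_zero_of_lt (by omega), Nat.cast_zero, zero_div, zero_sub, abs_neg,
          abs_of_nonneg (by positivity)]
        rw [Nat.choose_eq_zero_of_lt hkd, Nat.cast_zero, zero_div, zero_sub, abs_neg,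
          abs_of_nonneg (by positivity)] at ih
        have h1 : ((k : ℝ) / n) ^ (d + 1) ≤ ((k : ℝ) / n) ^ d :=
          pow_le_pow_of_le_one hkn0 hkn (by omega)
        have h2 : 0 ≤ (d : ℝ) / ((n : ℝ) - d) := div_nonneg hd0 (by linarith)
        linarith
      · have h1 : (k.choose (d + 1) : ℝ) * (d + 1) = k.choose d * ((k : ℝ) - d) := by
          rw [← Nat.cast_sub hkd]; exact_mod_cast Nat.choose_succ_right_eq k d
        have h2 : (n.choose (d + 1) : ℝ) * (d + 1) = n.choose d * ((n : ℝ) - d) := by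
          rw [← Nat.cast_sub (by omega : d ≤ n)]; exact_mod_cast Nat.choose_succ_right_eq n d
        have hnd : (0 : ℝ) < (n : ℝ) - d := by linarith
        have hkd' : (d : ℝ) ≤ k := by exact_mod_cast hkd
        have hkn' : (k : ℝ) ≤ n := by exact_mod_cast hk
        have h3 : (k.choose (d + 1) : ℝ) / n.choose (d + 1) =
            (k.choose d : ℝ) / n.choose d * (((k : ℝ) - d) / ((n : ℝ) - d)) := by
          have hd1 : (d : ℝ) + 1 ≠ 0 := by positivity
          rw [← mul_div_mul_right _ _ hd1, h1, h2, div_mul_div_comm]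
        have h4 : |((k : ℝ) - d) / ((n : ℝ) - d) - (k : ℝ) / n| ≤ d / ((n : ℝ) - d) := by
          have : ((k : ℝ) - d) / ((n : ℝ) - d) - (k : ℝ) / n =
              -(d / ((n : ℝ) - d) * (((n : ℝ) - k) / n)) := by
            field_simp
            ring
          rw [this, abs_neg, abs_of_nonneg (by
            have : 0 ≤ (n : ℝ) - k := by linarith
            positivity)]
          refine mul_le_of_le_one_right (by positivity) ?_
          rw [div_le_one hn]
          linarith [k.cast_nonneg (α := ℝ)]
        have h5 : |((k : ℝ) - d) / ((n : ℝ) - d)| ≤ 1 := by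
          rw [abs_of_nonneg (div_nonneg (by linarith) hnd.le), div_le_one hnd]
          linarith
        have h6 : |((k : ℝ) / n) ^ d| ≤ 1 := by
          rw [abs_of_nonneg (by positivity)]
          exact pow_le_one₀ hkn0 hkn
        rw [h3]
        calc _ = |((k.choose d : ℝ) / n.choose d - ((k : ℝ) / n) ^ d) *
                (((k : ℝ) - d) / ((n : ℝ) - d)) +
              ((k : ℝ) / n) ^ d * (((k : ℝ) - d) / ((n : ℝ) - d) - (k : ℝ) / n)| := by
              congr 1; ring
          _ ≤ _ := by
              refine (abs_add_le _ _).trans (add_le_add ?_ ?_)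
              · rw [abs_mul]
                exact (mul_le_of_le_one_right (abs_nonneg _) h5).trans ih
              · rw [abs_mul]
                exact (mul_le_of_le_one_left (abs_nonneg _) h6).trans h4
    refine hstep.trans ?_
    rw [← add_div]
    have : (0 : ℝ) < n - (d + 1) := by linarith
    push_cast
    gcongr
    · linarith
    · nlinarith

/-- A linear functional on polynomials which is nonnegative on the polynomials `X ^ k * (1 - X) ^ l`
is nonnegative on every polynomial which is nonnegative on the unit interval. -/
theorem nonneg_of_nonneg_on_Icc (Λ : ℝ[X] →ₗ[ℝ] ℝ)
    (hΛ : ∀ k l : ℕ, 0 ≤ Λ (X ^ k * (1 - X) ^ l)) {q : ℝ[X]}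
    (hq : ∀ t ∈ Set.Icc (0 : ℝ) 1, 0 ≤ q.eval t) : 0 ≤ Λ q := by
  have hbern : ∀ n k, 0 ≤ Λ (bernsteinPolynomial ℝ n k) := fun n k => by
    rw [bernsteinPolynomial, mul_assoc, ← C_eq_natCast (R := ℝ), ← smul_eq_C_mul, map_smul]
    exact mul_nonneg (Nat.cast_nonneg _) (hΛ _ _)
  set D := q.natDegree with hD
  set ε : ℕ → ℝ := fun n => ∑ d ∈ range (D + 1), |q.coeff d| * (d * d / ((n : ℝ) - d)) with hε
  -- Each Bernstein coefficient of q is within ε n of the value q(k/n) ≥ 0, and the Λ-values of the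
  -- Bernstein polynomials are nonnegative with sum Λ 1. Then n → ∞.
  have hlower : ∀ n, D < n → -(ε n * Λ 1) ≤ Λ q := by
    intro n hn
    have hqs : q = ∑ k ∈ range (n + 1), (∑ d ∈ range (D + 1),
        q.coeff d * ((k.choose d : ℝ) / n.choose d)) • bernsteinPolynomial ℝ n k := by
      conv_lhs => rw [q.as_sum_range_C_mul_X_pow]
      simp only [sum_smul]
      rw [sum_comm]
      refine sum_congr rfl fun d hd => ?_
      have hdn : d ≤ n := by have := mem_range.mp hd; omega
      rw [X_pow_eq_sum_bernsteinPolynomial hdn, ← smul_eq_C_mul, smul_sum]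
      exact sum_congr rfl fun k _ => by rw [smul_smul]
    have h1 : Λ 1 = ∑ k ∈ range (n + 1), Λ (bernsteinPolynomial ℝ n k) := by
      rw [← map_sum, bernsteinPolynomial.sum]
    have h2 : Λ q = ∑ k ∈ range (n + 1), (∑ d ∈ range (D + 1),
        q.coeff d * ((k.choose d : ℝ) / n.choose d)) * Λ (bernsteinPolynomial ℝ n k) := by
      conv_lhs => rw [hqs]
      rw [map_sum]
      exact sum_congr rfl fun k _ => by rw [map_smul, smul_eq_mul]
    rw [h1, h2, mul_sum, ← sum_neg_distrib]
    refine sum_le_sum fun k hk => ?_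
    rw [← neg_mul]
    refine mul_le_mul_of_nonneg_right ?_ (hbern n k)
    have hkn : k ≤ n := Nat.lt_succ_iff.mp (mem_range.mp hk)
    have hn0 : (0 : ℝ) < n := by exact_mod_cast (Nat.zero_le D).trans_lt hn
    have h3 := hq ((k : ℝ) / n)
      ⟨by positivity, div_le_one_of_le₀ (by exact_mod_cast hkn) hn0.le⟩
    rw [eval_eq_sum_range] at h3
    have h4 : |∑ d ∈ range (D + 1), q.coeff d * ((k.choose d : ℝ) / n.choose d) -
        ∑ d ∈ range (D + 1), q.coeff d * ((k : ℝ) / n) ^ d| ≤ ε n := by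
      rw [← sum_sub_distrib]
      refine (abs_sum_le_sum_abs _ _).trans (sum_le_sum fun d hd => ?_)
      rw [← mul_sub, abs_mul]
      gcongr
      exact abs_choose_div_sub_pow_le (by have := mem_range.mp hd; omega) hkn
    linarith [(abs_le.mp h4).1]
  have hεt : Tendsto (fun n => -(ε n * Λ 1)) atTop (𝓝 0) := by
    have h1 : Tendsto ε atTop (𝓝 (∑ d ∈ range (D + 1), |q.coeff d| * 0)) := by
      refine tendsto_finsetSum _ fun d _ => Tendsto.const_mul _ ?_
      exact Tendsto.div_atTop tendsto_const_nhds
        (tendsto_atTop_add_const_right _ _ tendsto_natCast_atTop_atTop)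
    simpa using (h1.mul_const (Λ 1)).neg
  exact le_of_tendsto hεt ((eventually_gt_atTop D).mono hlower)

end HausdorffMoment

/-! ### Complex families with completely monotone moments. -/

namespace HausdorffMoment

open Filter Topology Finset Polynomial ComplexConjugate

variable {ι : Type*} {x : ι → ℂ}

theorem exists_norm_aeval_le (p : ℝ[X]) (r : ℝ) : ∃ D : ℝ, ∀ w : ℂ, ‖w‖ ≤ r → ‖aeval w p‖ ≤ D := by
  have h := (isCompact_closedBall (0 : ℂ) r).exists_bound_of_continuousOn
    (f := fun w => aeval w p) p.continuous_aeval.continuousOn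
  obtain ⟨D, hD⟩ := h
  exact ⟨D, fun w hw => hD w (by simpa using hw)⟩

theorem summable_mul_aeval (hx : Summable fun i => ‖x i‖) (p : ℝ[X]) :
    Summable fun i => x i * aeval (x i) p := by
  obtain ⟨D, hD⟩ := exists_norm_aeval_le p 1
  refine Summable.of_norm_bounded_eventually (g := fun i => ‖x i‖ * D) (hx.mul_right D) ?_
  filter_upwards [hx.tendsto_cofinite_zero.eventually_le_const one_pos] with i hi
  rw [norm_mul]
  gcongr
  exact hD _ hi

/-- The functional `p ↦ Re ∑ x i * p (x i)`. -/
noncomputable def functional (hx : Summable fun i => ‖x i‖) : ℝ[X] →ₗ[ℝ] ℝ where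
  toFun p := (∑' i, x i * aeval (x i) p).re
  map_add' p q := by
    simp only [map_add, mul_add]
    rw [(summable_mul_aeval hx p).tsum_add (summable_mul_aeval hx q), Complex.add_re]
  map_smul' c p := by
    simp only [map_smul, Complex.real_smul, RingHom.id_apply, smul_eq_mul]
    rw [← Complex.re_ofReal_mul, ← tsum_mul_left]
    congr 1
    exact tsum_congr fun i => by ring

/-- For nonreal c the pair c, 1 is a real basis of ℂ; the bounds depend on u only through |u|. -/
theorem exists_linear_eq {c u : ℂ} (hc : c.im ≠ 0) :
    ∃ α β : ℝ, (α : ℂ) * c + β = u ∧ |α| ≤ ‖u‖ / |c.im| ∧ |β| ≤ ‖u‖ + ‖u‖ / |c.im| * ‖c‖ := by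
  have h1 : |u.im / c.im| ≤ ‖u‖ / |c.im| := by
    rw [abs_div]
    gcongr
    exact Complex.abs_im_le_norm u
  refine ⟨u.im / c.im, u.re - u.im / c.im * c.re, ?_, h1, ?_⟩
  · apply Complex.ext
    · simp
    · simp [hc]
  · refine (abs_sub _ _).trans (add_le_add (Complex.abs_re_le_norm u) ?_)
    rw [abs_mul]
    gcongr
    exact Complex.abs_re_le_norm c

/-- Given a real polynomial `p` and a point `c` outside `[0, ∞)` with `p c ≠ 0`, some real linear
factor turns `c * (c ^ N * p c) ^ 2` into a negative real number. -/
theorem exists_linear_factor {c : ℂ} (hc : ¬ 0 ≤ c) (p : ℝ[X]) (hp : aeval c p ≠ 0) :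
    ∃ B : ℝ, ∀ N : ℕ, ∃ α β : ℝ, |α| ≤ B ∧ |β| ≤ B ∧
      c * (c ^ N * aeval c p * (α * c + β)) ^ 2 = -((‖c‖ ^ N) ^ 2 : ℝ) := by
  have hc0 : c ≠ 0 := fun h => hc (by rw [h])
  have hcn : ‖c‖ ≠ 0 := norm_ne_zero_iff.mpr hc0
  rcases eq_or_ne c.im 0 with him | him
  · obtain ⟨y, rfl⟩ : ∃ y : ℝ, c = y := ⟨c.re, Complex.ext rfl (by simp [him])⟩
    have hy : y < 0 := by
      by_contra hcon
      exact hc (by exact_mod_cast not_lt.mp hcon)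
    have hpy : aeval (y : ℂ) p = ((p.eval y : ℝ) : ℂ) := by
      rw [← Complex.coe_algebraMap, aeval_algebraMap_apply, coe_aeval_eq_eval]
    rw [hpy] at hp ⊢
    have hp' : p.eval y ≠ 0 := by exact_mod_cast hp
    -- For negative c = y a constant factor suffices: its square contributes 1/(-y p(y)²).
    refine ⟨|1 / (Real.sqrt (-y) * p.eval y)|, fun N =>
      ⟨0, 1 / (Real.sqrt (-y) * p.eval y), by rw [abs_zero]; positivity, le_rfl, ?_⟩⟩
    have hs : Real.sqrt (-y) ^ 2 = -y := Real.sq_sqrt (by linarith)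
    have hs0 : Real.sqrt (-y) ≠ 0 := (Real.sqrt_pos.mpr (by linarith)).ne'
    have h1 : y * (y ^ N * p.eval y * (0 * y + 1 / (Real.sqrt (-y) * p.eval y))) ^ 2 =
        -((|y| ^ N) ^ 2) := by
      rw [← pow_mul, mul_comm N 2, pow_mul, sq_abs, zero_mul, zero_add]
      field_simp
      rw [hs]
      ring
    rw [Complex.norm_real, Real.norm_eq_abs]
    exact_mod_cast congrArg (fun z : ℝ => (z : ℂ)) h1
  -- Since c τ² = -1, the whole factor squared should be τ|c|^N squared. The value then required of
  -- αc + β has modulus κ, independent of N, hence a uniform B.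
  · obtain ⟨τ, hτ⟩ := IsAlgClosed.exists_pow_nat_eq (-c⁻¹) (n := 2) (by norm_num)
    set κ := ‖τ‖ / ‖aeval c p‖ with hκ
    refine ⟨max (κ / |c.im|) (κ + κ / |c.im| * ‖c‖), fun N => ?_⟩
    obtain ⟨α, β, h1, h2, h3⟩ :=
      exists_linear_eq (u := τ * (‖c‖ : ℂ) ^ N / (c ^ N * aeval c p)) him
    have hu : ‖τ * (‖c‖ : ℂ) ^ N / (c ^ N * aeval c p)‖ = κ := by
      rw [norm_div, norm_mul, norm_mul, norm_pow, norm_pow, Complex.norm_real, norm_norm, hκ]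
      field_simp
    rw [hu] at h2 h3
    refine ⟨α, β, h2.trans (le_max_left _ _), h3.trans (le_max_right _ _), ?_⟩
    rw [h1]
    have : c ^ N * aeval c p * (τ * (‖c‖ : ℂ) ^ N / (c ^ N * aeval c p)) = τ * (‖c‖ : ℂ) ^ N := by
      field_simp
    rw [this, mul_pow, hτ]
    push_cast
    field_simp

/-- The product of the real quadratics (X - a)(X - conj a) over the points a to be killed; c is a
root of none of them. -/
theorem exists_annihilator (S : Finset ι) (x : ι → ℂ) (c : ℂ) :
    ∃ p : ℝ[X], aeval c p ≠ 0 ∧ ∀ i ∈ S, x i ≠ c → x i ≠ conj c → aeval (x i) p = 0 := by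
  classical
  set S' := S.filter fun i => x i ≠ c ∧ x i ≠ conj c
  have hquad : ∀ a w : ℂ, aeval w (X ^ 2 - C (2 * a.re) * X + C (‖a‖ ^ 2) : ℝ[X]) =
      (w - a) * (w - conj a) := by
    intro a w
    simp only [map_add, map_sub, map_mul, map_pow, aeval_X, aeval_C, Complex.coe_algebraMap]
    have h1 : ((‖a‖ : ℂ)) ^ 2 = a * conj a := by rw [Complex.mul_conj, Complex.normSq_eq_norm_sq]; simp
    have h2 : (2 : ℂ) * (a.re : ℂ) = a + conj a := by rw [Complex.add_conj]; simp
    push_cast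
    rw [h1, h2]
    ring
  refine ⟨∏ i ∈ S', (X ^ 2 - C (2 * (x i).re) * X + C (‖x i‖ ^ 2)), ?_, fun i hi h1 h2 => ?_⟩
  · rw [map_prod, prod_ne_zero_iff]
    intro i hi
    obtain ⟨-, h1, h2⟩ := mem_filter.mp hi
    rw [hquad]
    refine mul_ne_zero (sub_ne_zero.mpr h1.symm) (sub_ne_zero.mpr fun h => h2 ?_)
    rw [h, Complex.conj_conj]
  · rw [map_prod]
    refine prod_eq_zero (i := i) (mem_filter.mpr ⟨hi, h1, h2⟩) ?_
    rw [hquad, sub_self, zero_mul]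

/-- An absolutely summable family of complex numbers whose weighted moments form a completely
monotone sequence consists of nonnegative real numbers. -/
theorem nonneg_of_moments (hx : Summable fun i => ‖x i‖)
    (hpos : ∀ k l : ℕ, 0 ≤ (∑' i, x i ^ (k + 1) * (1 - x i) ^ l).re) (i₀ : ι) : 0 ≤ x i₀ := by
  classical
  -- The contradiction comes from q = X^N p (αX + β). Here p kills the finitely many points with
  -- |x_i| ≥ |c| other than c and its conjugate, and the linear factor makes c q(c)² = -|c|^(2N).
  -- Points of smaller modulus are negligible relative to |c|^(2N) for large N, so Re Σ x_i q(x_i)²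
  -- < 0.
  by_contra hc
  set c := x i₀ with hcdef
  have hc0 : c ≠ 0 := fun h => hc (by rw [h])
  have hcn : 0 < ‖c‖ := norm_pos_iff.mpr hc0
  have hfin : {i | ‖c‖ ≤ ‖x i‖}.Finite := by
    have := hx.tendsto_cofinite_zero.eventually_lt_const hcn
    rw [eventually_cofinite] at this
    simpa only [not_lt] using this
  obtain ⟨p, hp0, hp⟩ := exists_annihilator hfin.toFinset x c
  obtain ⟨B, hB⟩ := exists_linear_factor hc p hp0
  obtain ⟨D, hD⟩ := exists_norm_aeval_le p ‖c‖
  have hB0 : 0 ≤ B := by obtain ⟨α, β, h, -⟩ := hB 0; exact (abs_nonneg _).trans h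
  have hD0 : 0 ≤ D := (norm_nonneg _).trans (hD 0 (by simp))
  set E : ℝ := (D * (B * ‖c‖ + B)) ^ 2 with hE
  -- A bound for the contribution of the points with |x_i| < |c|, divided by |c|^(2N). It is
  -- dominated by E|x_i| and tends to 0 pointwise, so its sum falls below 1.
  set s : ℕ → ι → ℝ := fun N i =>
    if ‖x i‖ < ‖c‖ then E * ‖x i‖ * ((‖x i‖ / ‖c‖) ^ 2) ^ N else 0 with hs
  have hs0 : ∀ N i, 0 ≤ s N i := fun N i => by
    simp only [hs]
    split_ifs <;> positivity
  have hsle : ∀ N i, s N i ≤ E * ‖x i‖ := fun N i => by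
    simp only [hs]
    split_ifs with h
    · refine mul_le_of_le_one_right (by positivity) (pow_le_one₀ (by positivity) ?_)
      exact pow_le_one₀ (by positivity) ((div_lt_one hcn).mpr h).le
    · positivity
  have hlim : Tendsto (fun N => ∑' i, s N i) atTop (𝓝 (∑' _ : ι, 0)) := by
    refine tendsto_tsum_of_dominated_convergence (hx.mul_left E) (fun i => ?_)
      (Eventually.of_forall fun N i => ?_)
    · simp only [hs]
      split_ifs with h
      · have h1 := tendsto_pow_atTop_nhds_zero_of_lt_one (r := (‖x i‖ / ‖c‖) ^ 2) (by positivity)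
          (pow_lt_one₀ (by positivity) ((div_lt_one hcn).mpr h) two_ne_zero)
        simpa using h1.const_mul (E * ‖x i‖)
      · exact tendsto_const_nhds
    · rw [Real.norm_eq_abs, abs_of_nonneg (hs0 N i)]
      exact hsle N i
  rw [tsum_zero] at hlim
  obtain ⟨N, hN⟩ := (hlim.eventually_lt_const one_pos).exists
  have hsN : Summable (s N) := (hx.mul_left E).of_nonneg_of_le (hs0 N) (hsle N)
  obtain ⟨α, β, hα, hβ, hval⟩ := hB N
  set q : ℝ[X] := X ^ N * p * (C α * X + C β) with hq
  have hqe : ∀ w : ℂ, aeval w q = w ^ N * aeval w p * (α * w + β) := fun w => by simp [hq]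
  have hterm : ∀ i, (x i * aeval (x i) (q ^ 2)).re ≤
      (‖c‖ ^ N) ^ 2 * (s N i - if i = i₀ then 1 else 0) := by
    intro i
    rw [map_pow, hqe]
    rcases lt_or_ge ‖x i‖ ‖c‖ with h | h
    · have hi : i ≠ i₀ := by rintro rfl; exact lt_irrefl _ h
      rw [if_neg hi, sub_zero]
      refine (Complex.re_le_norm _).trans ?_
      simp only [hs, if_pos h]
      rw [norm_mul, norm_pow, norm_mul, norm_mul, norm_pow]
      have h1 : ‖(α : ℂ) * x i + β‖ ≤ B * ‖c‖ + B := by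
        refine (norm_add_le _ _).trans ?_
        rw [norm_mul, Complex.norm_real, Complex.norm_real, Real.norm_eq_abs, Real.norm_eq_abs]
        gcongr
      calc ‖x i‖ * (‖x i‖ ^ N * ‖aeval (x i) p‖ * ‖(α : ℂ) * x i + β‖) ^ 2
          ≤ ‖x i‖ * (‖x i‖ ^ N * D * (B * ‖c‖ + B)) ^ 2 := by
            gcongr
            exact hD _ h.le
        _ = _ := by
            rw [hE, div_pow, div_pow]
            field_simp
            ring
    · have hsi : s N i = 0 := by simp only [hs, if_neg (not_lt.mpr h)]
      rw [hsi]
      have hneg : -(‖c‖ ^ N) ^ 2 ≤ (‖c‖ ^ N) ^ 2 * (0 - if i = i₀ then (1 : ℝ) else 0) := by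
        split_ifs
        · linarith
        · simp
      rcases eq_or_ne (x i) c with h1 | h1
      · rw [h1, hval, ← Complex.ofReal_neg, Complex.ofReal_re]
        exact hneg
      rcases eq_or_ne (x i) (conj c) with h2 | h2
      · have h3 : aeval (conj c) p = conj (aeval c p) := aeval_conj p c
        have h4 : conj c * (conj c ^ N * aeval (conj c) p * (α * conj c + β)) ^ 2 =
            conj (c * (c ^ N * aeval c p * (α * c + β)) ^ 2) := by
          rw [h3]
          simp
        rw [h2, h4, hval, Complex.conj_re, ← Complex.ofReal_neg, Complex.ofReal_re]
        exact hneg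
      · have hi : i ≠ i₀ := by rintro rfl; exact h1 rfl
        rw [hp i (by simpa using h) h1 h2]
        simp [hi]
  have hL : 0 ≤ functional hx (q ^ 2) := by
    refine nonneg_of_nonneg_on_Icc _ (fun k l => ?_) fun t _ => ?_
    · refine (hpos k l).trans_eq ?_
      change _ = (∑' i, x i * aeval (x i) (X ^ k * (1 - X) ^ l : ℝ[X])).re
      congr 1
      exact tsum_congr fun i => by simp; ring
    · rw [eval_pow]
      positivity
  have hsingle : HasSum (fun i => if i = i₀ then (1 : ℝ) else 0) 1 := hasSum_ite_eq i₀ 1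
  have hsumm := summable_mul_aeval hx (q ^ 2)
  have hle : functional hx (q ^ 2) ≤ (‖c‖ ^ N) ^ 2 * ((∑' i, s N i) - 1) := by
    change (∑' i, x i * aeval (x i) (q ^ 2)).re ≤ _
    rw [Complex.re_tsum hsumm]
    exact hasSum_le hterm (Complex.hasSum_re hsumm.hasSum).summable.hasSum
      ((hsN.hasSum.sub hsingle).mul_left _)
  have : (‖c‖ ^ N) ^ 2 * ((∑' i, s N i) - 1) < 0 :=
    mul_neg_of_pos_of_neg (by positivity) (by linarith)
  linarith

end HausdorffMoment

/-! ### Theta functions of characters and their decay. -/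

namespace RealCharXi

open Filter Topology Set Asymptotics
open scoped ZMod

theorem isBigO_sum_exp_neg {ι : Type*} (s : Finset ι) {f : ι → ℝ → ℂ} {h : ℝ → ℝ}
    (hf : ∀ i ∈ s, ∃ p : ℝ, 0 < p ∧ f i =O[atTop] fun x => h x * Real.exp (-p * x)) :
    ∃ p : ℝ, 0 < p ∧ (fun x => ∑ i ∈ s, f i x) =O[atTop] fun x => h x * Real.exp (-p * x) := by
  classical
  have hmono : ∀ {p q : ℝ}, p ≤ q →
      (fun x => h x * Real.exp (-q * x)) =O[atTop] fun x => h x * Real.exp (-p * x) := by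
    intro p q hpq
    refine (isBigO_refl _ _).mul (IsBigO.of_bound 1 ?_)
    filter_upwards [eventually_ge_atTop 0] with x hx
    rw [one_mul, Real.norm_eq_abs, Real.norm_eq_abs, Real.abs_exp, Real.abs_exp, Real.exp_le_exp]
    nlinarith
  induction s using Finset.induction_on with
  | empty => exact ⟨1, one_pos, by simpa using isBigO_zero _ _⟩
  | insert i s hi ih =>
    obtain ⟨p, hp, h1⟩ := ih fun j hj => hf j (Finset.mem_insert_of_mem hj)
    obtain ⟨q, hq, h2⟩ := hf i (Finset.mem_insert_self i s)
    refine ⟨min p q, lt_min hp hq, ?_⟩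
    simp only [Finset.sum_insert hi]
    exact (h2.trans (hmono (min_le_right _ _))).add (h1.trans (hmono (min_le_left _ _)))

variable {m : ℕ}

theorem level_ne_one {χ : DirichletCharacter ℂ m} (hχ : χ ≠ 1) : m ≠ 1 :=
  fun h => hχ (DirichletCharacter.level_one' χ h)

theorem parity_cases (χ : DirichletCharacter ℂ m) :
    (parity χ = 0 ∧ χ (-1) = 1) ∨ (parity χ = 1 ∧ χ (-1) = -1) := by
  by_cases h : χ (-1) = 1
  · exact Or.inl ⟨by simp [parity, h], h⟩
  · exact Or.inr ⟨by simp [parity, h], χ.even_or_odd.resolve_left h⟩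

variable [NeZero m]

/-- The theta function `∑ₙ n ^ a * χ n * exp (-π n² x)` of a Dirichlet character. -/
noncomputable def theta (χ : DirichletCharacter ℂ m) (x : ℝ) : ℂ :=
  ∑' n : ℤ, (n : ℂ) ^ parity χ * χ (n : ZMod m) * Real.exp (-Real.pi * n ^ 2 * x)

/-- Finite Fourier inversion. It writes theta as a combination of Hurwitz kernels, whose asymptotics
and functional equations carry over. -/
theorem apply_intCast_eq_sum (χ : DirichletCharacter ℂ m) (n : ℤ) :
    χ (n : ZMod m) = ∑ j : ZMod m, (m : ℂ)⁻¹ * (𝓕 (χ : ZMod m → ℂ)) j *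
      Complex.exp (2 * Real.pi * Complex.I * ((j.val / m : ℝ) : ℂ) * n) := by
  have h1 : (𝓕⁻ (𝓕 (χ : ZMod m → ℂ))) (n : ZMod m) = χ (n : ZMod m) := by
    rw [LinearEquiv.symm_apply_apply]
  rw [← h1, ZMod.invDFT_apply, smul_eq_mul, Finset.mul_sum]
  refine Finset.sum_congr rfl fun j _ => ?_
  have h2 : j * (n : ZMod m) = (((j.val : ℤ) * n : ℤ) : ZMod m) := by simp
  have h3 : (2 * Real.pi * Complex.I * (((j.val : ℤ) * n : ℤ) : ℂ) / m : ℂ) =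
      2 * Real.pi * Complex.I * ((j.val / m : ℝ) : ℂ) * n := by
    push_cast
    ring
  rw [h2, ZMod.stdAddChar_coe, smul_eq_mul, h3]
  ring

theorem dft_zero_eq_zero {χ : DirichletCharacter ℂ m} (hχ : χ ≠ 1) :
    (𝓕 (χ : ZMod m → ℂ)) 0 = 0 := by
  rw [ZMod.dft_apply_zero]
  exact χ.sum_eq_zero_of_ne_one hχ

/-- The kernels whose linear combinations give the theta function of a character. -/
noncomputable def kernel (a : ℕ) (u : UnitAddCircle) (x : ℝ) : ℂ :=
  if a = 0 then (HurwitzZeta.cosKernel u x : ℂ) else Complex.I * HurwitzZeta.sinKernel u x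

theorem hasSum_theta_kernel (χ : DirichletCharacter ℂ m) {x : ℝ} (hx : 0 < x) :
    HasSum (fun n : ℤ => (n : ℂ) ^ parity χ * χ (n : ZMod m) * Real.exp (-Real.pi * n ^ 2 * x))
      (∑ j : ZMod m, (m : ℂ)⁻¹ * (𝓕 (χ : ZMod m → ℂ)) j *
        kernel (parity χ) (ZMod.toAddCircle j) x) := by
  have h1 : ∀ j : ZMod m, HasSum (fun n : ℤ => (n : ℂ) ^ parity χ *
      Complex.exp (2 * Real.pi * Complex.I * ((j.val / m : ℝ) : ℂ) * n) *
        Real.exp (-Real.pi * n ^ 2 * x)) (kernel (parity χ) (ZMod.toAddCircle j) x) := by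
    intro j
    rw [ZMod.toAddCircle_apply]
    rcases parity_cases χ with ⟨h, -⟩ | ⟨h, -⟩
    · rw [h, kernel, if_pos rfl]
      simpa using HurwitzZeta.hasSum_int_cosKernel (j.val / m) hx
    · rw [h, kernel, if_neg one_ne_zero]
      refine ((HurwitzZeta.hasSum_int_sinKernel (j.val / m) hx).mul_left Complex.I).congr_fun
        fun n => ?_
      rw [pow_one]
      linear_combination ((n : ℂ) *
        Complex.exp (2 * Real.pi * Complex.I * ((j.val / m : ℝ) : ℂ) * n) *
        Real.exp (-Real.pi * n ^ 2 * x)) * Complex.I_mul_I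
  have h2 := hasSum_sum (s := Finset.univ) fun j _ =>
    (h1 j).mul_left ((m : ℂ)⁻¹ * (𝓕 (χ : ZMod m → ℂ)) j)
  refine h2.congr_fun fun n => ?_
  rw [apply_intCast_eq_sum χ n, Finset.mul_sum, Finset.sum_mul]
  exact Finset.sum_congr rfl fun j _ => by ring

theorem hasSum_theta (χ : DirichletCharacter ℂ m) {x : ℝ} (hx : 0 < x) :
    HasSum (fun n : ℤ => (n : ℂ) ^ parity χ * χ (n : ZMod m) * Real.exp (-Real.pi * n ^ 2 * x))
      (theta χ x) :=
  (hasSum_theta_kernel χ hx).summable.hasSum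

theorem theta_eq_sum_kernel (χ : DirichletCharacter ℂ m) {x : ℝ} (hx : 0 < x) :
    theta χ x = ∑ j : ZMod m, (m : ℂ)⁻¹ * (𝓕 (χ : ZMod m → ℂ)) j *
        kernel (parity χ) (ZMod.toAddCircle j) x :=
  (hasSum_theta_kernel χ hx).tsum_eq

theorem continuousOn_theta (χ : DirichletCharacter ℂ m) : ContinuousOn (theta χ) (Ioi 0) := by
  refine ContinuousOn.congr ?_ fun x hx => theta_eq_sum_kernel χ hx
  refine continuousOn_finsetSum _ fun j _ => ContinuousOn.const_mul ?_ _
  rcases parity_cases χ with ⟨h, -⟩ | ⟨h, -⟩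
  · simp only [h]
    exact Complex.continuous_ofReal.comp_continuousOn (HurwitzZeta.continuousOn_cosKernel _)
  · simp only [h]
    exact (Complex.continuous_ofReal.comp_continuousOn
      (HurwitzZeta.continuousOn_sinKernel _)).const_mul _

theorem isBigO_ofReal {f : ℝ → ℝ} {g : ℝ → ℝ} (h : f =O[atTop] g) :
    (fun x => (f x : ℂ)) =O[atTop] g :=
  (isBigO_iff.mpr (by simpa using isBigO_iff.mp h))

theorem theta_isBigO_atTop {χ : DirichletCharacter ℂ m} (hχ : χ ≠ 1) :
    ∃ p : ℝ, 0 < p ∧ theta χ =O[atTop] fun x => Real.exp (-p * x) := by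
  set A : ZMod m → ℂ := fun j => (m : ℂ)⁻¹ * (𝓕 (χ : ZMod m → ℂ)) j with hA
  have hker : ∀ j, ∃ p : ℝ, 0 < p ∧
      (fun x => A j * (kernel (parity χ) (ZMod.toAddCircle j) x - if parity χ = 0 then 1 else 0))
        =O[atTop] fun x => 1 * Real.exp (-p * x) := by
    intro j
    simp only [one_mul]
    rcases parity_cases χ with ⟨h, -⟩ | ⟨h, -⟩
    · obtain ⟨p, hp, h1⟩ := HurwitzZeta.isBigO_atTop_cosKernel_sub (ZMod.toAddCircle j)
      refine ⟨p, hp, IsBigO.const_mul_left ?_ _⟩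
      simp only [h, kernel, if_true]
      exact_mod_cast isBigO_ofReal h1
    · obtain ⟨p, hp, h1⟩ := HurwitzZeta.isBigO_atTop_sinKernel (ZMod.toAddCircle j)
      refine ⟨p, hp, IsBigO.const_mul_left ?_ _⟩
      simp only [h, kernel, if_neg one_ne_zero, sub_zero]
      exact (isBigO_ofReal h1).const_mul_left _
  obtain ⟨p, hp, h1⟩ := isBigO_sum_exp_neg Finset.univ fun j _ => hker j
  refine ⟨p, hp, ?_⟩
  simp only [one_mul] at h1
  refine IsBigO.congr' h1 ?_ EventuallyEq.rfl
  filter_upwards [eventually_gt_atTop 0] with x hx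
  rw [theta_eq_sum_kernel χ hx]
  simp only [mul_sub, Finset.sum_sub_distrib]
  rw [sub_eq_self, ← Finset.sum_mul]
  -- In the even case each kernel tends to 1; the constants cancel because their weights add up to
  -- χ(0) = 0.
  have h0 : ∑ j, A j = χ (0 : ZMod m) := by
    have := apply_intCast_eq_sum χ 0
    simpa using this.symm
  have : Fact (1 < m) := ⟨by
    have := level_ne_one hχ
    have := NeZero.ne m
    omega⟩
  rw [h0, MulChar.map_zero, zero_mul]

theorem theta_inv_isBigO_atTop {χ : DirichletCharacter ℂ m} (hχ : χ ≠ 1) :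
    ∃ p : ℝ, 0 < p ∧ (fun x => theta χ (1 / x)) =O[atTop] fun x => x ^ 2 * Real.exp (-p * x) := by
  set A : ZMod m → ℂ := fun j => (m : ℂ)⁻¹ * (𝓕 (χ : ZMod m → ℂ)) j with hA
  have hpow : ∀ r : ℝ, r ≤ 2 → (fun x : ℝ => x ^ r) =O[atTop] fun x : ℝ => x ^ 2 := by
    intro r hr
    refine IsBigO.of_bound 1 ?_
    filter_upwards [eventually_ge_atTop 1] with x hx
    rw [one_mul, Real.norm_of_nonneg (by positivity), Real.norm_of_nonneg (by positivity),
      ← Real.rpow_two]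
    exact Real.rpow_le_rpow_of_exponent_le hx hr
  have hker : ∀ j, ∃ p : ℝ, 0 < p ∧
      (fun x => A j * kernel (parity χ) (ZMod.toAddCircle j) (1 / x))
        =O[atTop] fun x => x ^ 2 * Real.exp (-p * x) := by
    intro j
    rcases parity_cases χ with ⟨h, -⟩ | ⟨h, -⟩
    -- After inversion only the kernel at j = 0 has a nonzero limit, and its weight is a multiple of
    -- the character sum Σ χ = 0.
    · rcases eq_or_ne j 0 with rfl | hj
      · refine ⟨1, one_pos, ?_⟩
        simp only [hA, dft_zero_eq_zero hχ, mul_zero, zero_mul]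
        exact isBigO_zero _ _
      · obtain ⟨p, hp, h1⟩ := HurwitzZeta.isBigO_atTop_evenKernel_sub (ZMod.toAddCircle j)
        simp only [ZMod.toAddCircle_eq_zero, if_neg hj, sub_zero] at h1
        refine ⟨p, hp, IsBigO.const_mul_left ?_ _⟩
        refine IsBigO.congr' (isBigO_ofReal ((hpow (1 / 2) (by norm_num)).mul h1)) ?_
          EventuallyEq.rfl
        filter_upwards [eventually_gt_atTop 0] with x hx
        simp only [h, kernel, if_true]
        rw [HurwitzZeta.evenKernel_functional_equation]
        have : x ^ (1 / 2 : ℝ) ≠ 0 := (Real.rpow_pos_of_pos hx _).ne'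
        congr 1
        field_simp
    · obtain ⟨p, hp, h1⟩ := HurwitzZeta.isBigO_atTop_oddKernel (ZMod.toAddCircle j)
      refine ⟨p, hp, IsBigO.const_mul_left ?_ _⟩
      refine IsBigO.congr' ((isBigO_ofReal ((hpow (3 / 2) (by norm_num)).mul h1)).const_mul_left
        Complex.I) ?_ EventuallyEq.rfl
      filter_upwards [eventually_gt_atTop 0] with x hx
      simp only [h, kernel, if_neg one_ne_zero]
      rw [HurwitzZeta.oddKernel_functional_equation]
      have : x ^ (3 / 2 : ℝ) ≠ 0 := (Real.rpow_pos_of_pos hx _).ne'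
      congr 2
      field_simp
  obtain ⟨p, hp, h1⟩ := isBigO_sum_exp_neg Finset.univ fun j _ => hker j
  refine ⟨p, hp, IsBigO.congr' h1 ?_ EventuallyEq.rfl⟩
  filter_upwards [eventually_gt_atTop 0] with x hx
  rw [theta_eq_sum_kernel χ (by positivity)]

end RealCharXi

/-! ### Decay of the kernel, its moments and its Fourier transform. -/

namespace RealCharXi

open Filter Topology Set Asymptotics MeasureTheory

/-- In the target, t⁴ pays for the weight exp(t⁴) used later and t² leaves an integrable Gaussian.
Each of t⁴, t² and Kt is eventually at most a third of p·exp(2t). -/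
theorem exp_mul_exp_neg_exp_isBigO (K : ℝ) {p : ℝ} (hp : 0 < p) :
    (fun t : ℝ => Real.exp (K * t) * Real.exp (-p * Real.exp (2 * t))) =O[atTop]
      fun t => Real.exp (-t ^ 4 - t ^ 2) := by
  have h : ∀ k : ℕ, ∀ c : ℝ, 0 < c → ∀ᶠ t : ℝ in atTop, t ^ k ≤ c * Real.exp (2 * t) := by
    intro k c hc
    filter_upwards [(isLittleO_pow_exp_pos_mul_atTop k (b := 2) (by norm_num)).bound hc,
      eventually_ge_atTop 0] with t ht ht0
    rwa [Real.norm_of_nonneg (by positivity), Real.norm_of_nonneg (by positivity)] at ht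
  refine IsBigO.of_bound 1 ?_
  filter_upwards [h 4 (p / 3) (by positivity), h 2 (p / 3) (by positivity),
    h 1 (p / 3 / (|K| + 1)) (by positivity), eventually_ge_atTop 0] with t h1 h2 h3 ht
  rw [one_mul, ← Real.exp_add, Real.norm_eq_abs, Real.norm_eq_abs, Real.abs_exp, Real.abs_exp,
    Real.exp_le_exp]
  have h4 : K * t ≤ p / 3 * Real.exp (2 * t) := by
    calc K * t ≤ (|K| + 1) * t := by
          gcongr
          linarith [le_abs_self K]
      _ ≤ (|K| + 1) * (p / 3 / (|K| + 1) * Real.exp (2 * t)) := by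
          gcongr
          simpa using h3
      _ = p / 3 * Real.exp (2 * t) := by
          have : |K| + 1 ≠ 0 := by positivity
          field_simp
  linarith

/-- A Young-type inequality, by comparing |t|³ with r. The conjugate exponent 4/3 of 4 bounds the
growth order of the transform; anything below 2 would do. -/
theorem mul_abs_le {r : ℝ} (hr : 0 ≤ r) (t : ℝ) : r * |t| ≤ r ^ (4 / 3 : ℝ) + t ^ 4 := by
  have ht : t ^ 4 = |t| ^ 4 := by rw [Even.pow_abs (by decide)]
  rcases le_total (|t| ^ 3) r with h | h
  · have h1 : |t| ≤ r ^ (1 / 3 : ℝ) := by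
      have := Real.rpow_le_rpow (by positivity) h (z := 1 / 3) (by norm_num)
      rwa [← Real.rpow_natCast, ← Real.rpow_mul (abs_nonneg t),
        show ((3 : ℕ) : ℝ) * (1 / 3) = 1 by norm_num, Real.rpow_one] at this
    have h2 : r ^ (4 / 3 : ℝ) = r * r ^ (1 / 3 : ℝ) := by
      rw [show (4 / 3 : ℝ) = 1 + 1 / 3 by norm_num,
        Real.rpow_add_of_nonneg hr (by norm_num) (by norm_num), Real.rpow_one]
    rw [h2]
    have h3 : r * |t| ≤ r * r ^ (1 / 3 : ℝ) := by gcongr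
    have h4 : 0 ≤ t ^ 4 := by positivity
    linarith
  · have h1 : r * |t| ≤ |t| ^ 3 * |t| := by gcongr
    have h2 : 0 ≤ r ^ (4 / 3 : ℝ) := by positivity
    rw [ht]
    nlinarith

/-- A function given everywhere by a convergent power series. -/
theorem hasFPowerSeriesOnBall_of_hasSum {c : ℕ → ℂ} {F : ℂ → ℂ}
    (h : ∀ z, HasSum (fun n => c n * z ^ n) (F z)) :
    HasFPowerSeriesOnBall F (FormalMultilinearSeries.ofScalars ℂ c) 0 ⊤ where
  r_le := by
    rw [FormalMultilinearSeries.radius_eq_top_of_summable_norm]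
    intro r
    refine (h r).summable.norm.congr fun n => ?_
    simp
  r_pos := by simp
  hasSum := fun {y} _ => by
    rw [zero_add]
    refine (h y).congr_fun fun n => ?_
    simp [mul_comm]

theorem iteratedDeriv_of_hasSum {c : ℕ → ℂ} {F : ℂ → ℂ}
    (h : ∀ z, HasSum (fun n => c n * z ^ n) (F z)) (n : ℕ) :
    iteratedDeriv n F 0 = n.factorial * c n := by
  have h1 := (hasFPowerSeriesOnBall_of_hasSum h).hasFPowerSeriesAt
  have h2 := h1.eq_formalMultilinearSeries h1.analyticAt.hasFPowerSeriesAt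
  have h3 := congrArg (fun p => FormalMultilinearSeries.coeff p n) h2
  simp only [FormalMultilinearSeries.coeff_ofScalars] at h3
  rw [h3]
  have : (n.factorial : ℂ) ≠ 0 := by exact_mod_cast n.factorial_ne_zero
  field_simp

variable {m : ℕ} [NeZero m] {χ : DirichletCharacter ℂ m}

theorem ofReal_phi (hreal : ∀ x : ZMod m, (χ x).im = 0) (t : ℝ) :
    (phi χ t : ℂ) = Real.exp (-((1 + 2 * (parity χ : ℝ)) / 2) * t) *
      theta χ (Real.exp (-(2 * t)) / m) := by
  rw [phi, Complex.ofReal_tsum, theta, ← tsum_mul_left]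
  refine tsum_congr fun n => ?_
  have h1 : ((χ (n : ZMod m)).re : ℂ) = χ (n : ZMod m) :=
    Complex.ext rfl (by simp [hreal])
  have h2 : -((n : ℝ) ^ 2 * Real.pi / (m * Real.exp (2 * t))) - (1 + 2 * (parity χ : ℝ)) / 2 * t =
      -((1 + 2 * (parity χ : ℝ)) / 2) * t + -Real.pi * n ^ 2 * (Real.exp (-(2 * t)) / m) := by
    rw [Real.exp_neg]
    have := Real.exp_ne_zero (2 * t)
    have : (m : ℝ) ≠ 0 := by exact_mod_cast NeZero.ne m
    field_simp
    ring
  rw [h2, Real.exp_add]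
  push_cast
  rw [h1]
  ring

theorem continuous_phi (hreal : ∀ x : ZMod m, (χ x).im = 0) : Continuous (phi χ) := by
  have hm : (0 : ℝ) < m := by exact_mod_cast NeZero.pos m
  have h1 : Continuous fun t => (phi χ t : ℂ) := by
    simp only [ofReal_phi hreal]
    refine (by fun_prop : Continuous _).mul ?_
    exact (continuousOn_theta χ).comp_continuous (by fun_prop) fun t => by
      rw [mem_Ioi]; positivity
  exact Complex.continuous_re.comp h1

theorem phi_isBigO_atTop (hχ : χ ≠ 1) (hreal : ∀ x : ZMod m, (χ x).im = 0) :
    phi χ =O[atTop] fun t => Real.exp (-t ^ 4 - t ^ 2) := by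
  have hm : (0 : ℝ) < m := by exact_mod_cast NeZero.pos m
  obtain ⟨p, hp, h1⟩ := theta_inv_isBigO_atTop hχ
  have htend : Tendsto (fun t : ℝ => m * Real.exp (2 * t)) atTop atTop :=
    (Real.tendsto_exp_atTop.comp (tendsto_id.const_mul_atTop two_pos)).const_mul_atTop hm
  set κ : ℝ := (1 + 2 * (parity χ : ℝ)) / 2
  have h2 : (fun t => (phi χ t : ℂ)) =O[atTop] fun t => Real.exp (-κ * t) *
      ((m * Real.exp (2 * t)) ^ 2 * Real.exp (-p * (m * Real.exp (2 * t)))) := by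
    simp only [ofReal_phi hreal]
    refine IsBigO.mul (isBigO_ofReal (isBigO_refl _ _)) ?_
    refine (h1.comp_tendsto htend).congr_left fun t => ?_
    simp only [Function.comp_apply]
    congr 1
    rw [Real.exp_neg]
    field_simp
  have h3 : phi χ =O[atTop] fun t => (m : ℝ) ^ 2 * (Real.exp ((4 - κ) * t) *
      Real.exp (-(p * m) * Real.exp (2 * t))) := by
    refine isBigO_norm_left.mp ?_
    refine (isBigO_norm_left.mpr h2).congr (fun t => by simp) fun t => ?_
    rw [mul_pow, ← Real.exp_nat_mul, show (4 - κ) * t = -κ * t + ((2 : ℕ) : ℝ) * (2 * t) by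
      push_cast; ring, Real.exp_add]
    ring_nf
  exact h3.trans ((exp_mul_exp_neg_exp_isBigO _ (by positivity)).const_mul_left _)

/-- As t → -∞ the theta argument goes to infinity, as t → +∞ it goes to 0; the two ends therefore
rest on the two theta estimates separately. -/
theorem phi_neg_isBigO_atTop (hχ : χ ≠ 1) (hreal : ∀ x : ZMod m, (χ x).im = 0) :
    (fun t => phi χ (-t)) =O[atTop] fun t => Real.exp (-t ^ 4 - t ^ 2) := by
  have hm : (0 : ℝ) < m := by exact_mod_cast NeZero.pos m
  obtain ⟨p, hp, h1⟩ := theta_isBigO_atTop hχ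
  have htend : Tendsto (fun t : ℝ => Real.exp (2 * t) / m) atTop atTop :=
    (Real.tendsto_exp_atTop.comp (tendsto_id.const_mul_atTop two_pos)).atTop_div_const hm
  set κ : ℝ := (1 + 2 * (parity χ : ℝ)) / 2
  have h2 : (fun t => (phi χ (-t) : ℂ)) =O[atTop] fun t => Real.exp (κ * t) *
      Real.exp (-p * (Real.exp (2 * t) / m)) := by
    simp only [ofReal_phi hreal]
    refine IsBigO.mul ((isBigO_ofReal (isBigO_refl _ _)).congr_left fun t => ?_) ?_
    · congr 2
      ring
    · refine (h1.comp_tendsto htend).congr_left fun t => ?_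
      simp only [Function.comp_apply]
      congr 3
      ring
  have h3 : (fun t => phi χ (-t)) =O[atTop] fun t => Real.exp (κ * t) *
      Real.exp (-(p / m) * Real.exp (2 * t)) := by
    refine isBigO_norm_left.mp ?_
    refine (isBigO_norm_left.mpr h2).congr (fun t => by simp) fun t => ?_
    congr 2
    ring
  exact h3.trans (exp_mul_exp_neg_exp_isBigO _ (by positivity))

theorem integrable_exp_pow_four_mul_phi (hχ : χ ≠ 1) (hreal : ∀ x : ZMod m, (χ x).im = 0) :
    Integrable fun t => Real.exp (t ^ 4) * phi χ t := by
  have hcont : Continuous fun t => Real.exp (t ^ 4) * phi χ t :=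
    (by fun_prop : Continuous fun t : ℝ => Real.exp (t ^ 4)).mul (continuous_phi hreal)
  have hg : Integrable fun t : ℝ => Real.exp (-1 * t ^ 2) := integrable_exp_neg_mul_sq one_pos
  have hexp : ∀ t : ℝ, Real.exp (t ^ 4) * Real.exp (-t ^ 4 - t ^ 2) = Real.exp (-1 * t ^ 2) := by
    intro t
    rw [← Real.exp_add]
    congr 1
    ring
  have htop : (fun t => Real.exp (t ^ 4) * phi χ t) =O[atTop] fun t => Real.exp (-1 * t ^ 2) :=
    ((isBigO_refl _ _).mul (phi_isBigO_atTop hχ hreal)).congr_right hexp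
  have hbot : (fun t => Real.exp (t ^ 4) * phi χ t) =O[atBot] fun t => Real.exp (-1 * t ^ 2) := by
    have h1 : (fun t : ℝ => Real.exp (t ^ 4) * phi χ (-t)) =O[atTop]
        fun t => Real.exp (-1 * t ^ 2) :=
      ((isBigO_refl _ _).mul (phi_neg_isBigO_atTop hχ hreal)).congr_right hexp
    refine (h1.comp_tendsto tendsto_neg_atBot_atTop).congr (fun t => ?_) fun t => ?_
    · simp only [Function.comp_apply, neg_neg]
      rw [Even.neg_pow (by decide)]
    · simp
  exact hcont.locallyIntegrable.integrable_of_isBigO_atBot_atTop hbot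
    (hg.integrableAtFilter _) htop (hg.integrableAtFilter _)

theorem integrable_exp_mul_abs_phi (hχ : χ ≠ 1) (hreal : ∀ x : ZMod m, (χ x).im = 0) {r : ℝ}
    (hr : 0 ≤ r) : Integrable fun t => Real.exp (r * |t|) * |phi χ t| := by
  refine ((integrable_exp_pow_four_mul_phi hχ hreal).norm.const_mul
    (Real.exp (r ^ (4 / 3 : ℝ)))).mono' ?_ (Eventually.of_forall fun t => ?_)
  · exact ((by fun_prop : Continuous fun t : ℝ => Real.exp (r * |t|)).mul
      (continuous_phi hreal).abs).aestronglyMeasurable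
  · rw [Real.norm_of_nonneg (by positivity), norm_mul, Real.norm_eq_abs, Real.abs_exp,
      Real.norm_eq_abs, ← mul_assoc, ← Real.exp_add]
    gcongr
    exact mul_abs_le hr t

theorem integrable_pow_mul_phi (hχ : χ ≠ 1) (hreal : ∀ x : ZMod m, (χ x).im = 0) (n : ℕ) :
    Integrable fun t => t ^ n * phi χ t := by
  refine ((integrable_exp_mul_abs_phi hχ hreal zero_le_one).const_mul (n.factorial : ℝ)).mono' ?_
    (Eventually.of_forall fun t => ?_)
  · exact ((continuous_pow n).mul (continuous_phi hreal)).aestronglyMeasurable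
  · rw [norm_mul, norm_pow, Real.norm_eq_abs, Real.norm_eq_abs, ← mul_assoc]
    gcongr
    have h := Real.pow_div_factorial_le_exp |t| (abs_nonneg t) n
    rw [div_le_iff₀ (by positivity)] at h
    rw [one_mul]
    linarith

/-- The Fourier transform of `phi` as an entire function. -/
noncomputable def phiTransform (χ : DirichletCharacter ℂ m) (z : ℂ) : ℂ :=
  ∫ t : ℝ, Complex.exp (-(Complex.I * z * t)) * phi χ t

theorem norm_cexp_le (z : ℂ) (t : ℝ) :
    ‖Complex.exp (-(Complex.I * z * t))‖ ≤ Real.exp (‖z‖ * |t|) := by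
  rw [Complex.norm_exp]
  gcongr
  refine (Complex.re_le_norm _).trans_eq ?_
  simp

theorem hasSum_phiTransform (hχ : χ ≠ 1) (hreal : ∀ x : ZMod m, (χ x).im = 0) (z : ℂ) :
    HasSum (fun n : ℕ => (-Complex.I) ^ n * b χ n / n.factorial * z ^ n) (phiTransform χ z) := by
  have hcoef : ∀ n : ℕ, (-Complex.I) ^ n * b χ n / n.factorial * z ^ n =
      ∫ t : ℝ, (-(Complex.I * z * t)) ^ n / n.factorial * phi χ t := by
    intro n
    rw [b, ← integral_complex_ofReal]
    have h1 : ∀ t : ℝ, (-(Complex.I * z * t)) ^ n / n.factorial * (phi χ t : ℂ) =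
        (-Complex.I) ^ n / n.factorial * z ^ n * ((t ^ n * phi χ t : ℝ) : ℂ) := fun t => by
      rw [show -(Complex.I * z * t) = -Complex.I * z * t by ring, mul_pow, mul_pow]
      push_cast
      ring
    simp only [h1]
    rw [integral_const_mul]
    ring
  simp only [hcoef]
  have hphi := continuous_phi hreal
  have hexp : ∀ t : ℝ, HasSum (fun n : ℕ => (‖z‖ * |t|) ^ n / n.factorial * |phi χ t|)
      (Real.exp (‖z‖ * |t|) * |phi χ t|) := fun t => by
    rw [Real.exp_eq_exp_ℝ]
    exact (NormedSpace.expSeries_div_hasSum_exp (‖z‖ * |t|)).mul_right _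
  refine hasSum_integral_of_dominated_convergence
    (fun n t => (‖z‖ * |t|) ^ n / n.factorial * |phi χ t|) (fun n => ?_) (fun n => ?_)
    (Eventually.of_forall fun t => (hexp t).summable) ?_ (Eventually.of_forall fun t => ?_)
  · exact ((by fun_prop : Continuous fun t : ℝ => (-(Complex.I * z * t)) ^ n / n.factorial).mul
      (Complex.continuous_ofReal.comp hphi)).aestronglyMeasurable
  · refine Eventually.of_forall fun t => le_of_eq ?_
    simp
  · simp only [fun t => (hexp t).tsum_eq]
    exact integrable_exp_mul_abs_phi hχ hreal (norm_nonneg z)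
  · rw [Complex.exp_eq_exp_ℂ]
    exact (NormedSpace.expSeries_div_hasSum_exp (-(Complex.I * z * t))).mul_right _

theorem differentiable_phiTransform (hχ : χ ≠ 1) (hreal : ∀ x : ZMod m, (χ x).im = 0) :
    Differentiable ℂ (phiTransform χ) := by
  have := (hasFPowerSeriesOnBall_of_hasSum (hasSum_phiTransform hχ hreal)).differentiableOn
  rwa [Metric.eball_top, differentiableOn_univ] at this

theorem norm_phiTransform_le (hχ : χ ≠ 1) (hreal : ∀ x : ZMod m, (χ x).im = 0) (z : ℂ) :
    ‖phiTransform χ z‖ ≤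
      Real.exp (‖z‖ ^ (4 / 3 : ℝ)) * ∫ t : ℝ, ‖Real.exp (t ^ 4) * phi χ t‖ := by
  rw [← integral_const_mul]
  refine norm_integral_le_of_norm_le ((integrable_exp_pow_four_mul_phi hχ hreal).norm.const_mul _)
    (Eventually.of_forall fun t => ?_)
  rw [norm_mul, norm_mul, ← mul_assoc, Real.norm_eq_abs (Real.exp _), Real.abs_exp,
    ← Real.exp_add, Complex.norm_real]
  gcongr
  refine (norm_cexp_le z t).trans ?_
  gcongr
  exact mul_abs_le (norm_nonneg z) t

end RealCharXi

/-! ### Ξ as the Fourier transform of the kernel. -/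

namespace RealCharXi

open Filter Topology Set MeasureTheory

variable {m : ℕ} [NeZero m] {χ : DirichletCharacter ℂ m}

theorem mellin_eq_integral_exp (f : ℝ → ℂ) (s : ℂ) :
    mellin f s = ∫ u : ℝ, Complex.exp (-s * u) * f (Real.exp (-u)) := by
  rw [mellin_eq_fourier, Real.fourier_eq']
  congr 1
  ext u
  rw [smul_eq_mul, Complex.real_smul, ← mul_assoc, Complex.ofReal_exp, ← Complex.exp_add]
  congr 2
  have : (Real.pi : ℂ) ≠ 0 := by exact_mod_cast Real.pi_ne_zero
  simp
  field_simp
  linear_combination (-(u : ℂ)) * Complex.re_add_im s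

theorem map_zero_of_ne_one (hχ : χ ≠ 1) : χ (0 : ZMod m) = 0 := by
  have : Fact (1 < m) := ⟨by
    have := level_ne_one hχ
    have := NeZero.ne m
    omega⟩
  exact MulChar.map_zero χ

/-- The Mellin transform of the theta function. -/
theorem mellin_theta (hχ : χ ≠ 1) {s : ℂ} (hs : 1 < s.re) :
    mellin (theta χ) ((s + parity χ) / 2) =
      2 * (Complex.Gammaℝ (s + parity χ) * DirichletCharacter.LFunction χ s) := by
  set a := parity χ with ha
  have h0 := map_zero_of_ne_one hχ
  have hre : (s + a).re = s.re + a := by simp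
  have hpos : 0 < (s + a).re := by
    rw [hre]
    have : (0 : ℝ) ≤ a := a.cast_nonneg
    linarith
  have hF : ∀ t ∈ Ioi (0 : ℝ), HasSum (fun n : ℤ => if (n : ℝ) = 0 then 0 else
      (n : ℂ) ^ a * χ (n : ZMod m) * Real.exp (-Real.pi * (n : ℝ) ^ 2 * t)) (theta χ t) := by
    intro t ht
    refine (hasSum_theta χ ht).congr_fun fun n => ?_
    split_ifs with hn
    · have : n = 0 := by exact_mod_cast hn
      simp [this, h0]
    · rfl
  have hsum : Summable fun n : ℤ => ‖(n : ℂ) ^ a * χ (n : ZMod m)‖ / |(n : ℝ)| ^ (s + a).re := by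
    refine (Real.summable_abs_int_rpow hs).of_nonneg_of_le (fun n => by positivity) fun n => ?_
    rcases eq_or_ne n 0 with rfl | hn
    · simp only [Int.cast_zero, h0, mul_zero, norm_zero, zero_div]
      positivity
    · have hn' : 0 < |(n : ℝ)| := abs_pos.mpr (by exact_mod_cast hn)
      rw [hre, Real.rpow_add hn', Real.rpow_natCast, Real.rpow_neg hn'.le, norm_mul, norm_pow,
        Complex.norm_intCast, ← div_div, div_eq_mul_inv, div_eq_mul_inv]
      have h1 : ‖χ (n : ZMod m)‖ ≤ 1 := χ.norm_le_one _
      have h2 : (|(n : ℝ)| ^ a * ‖χ (n : ZMod m)‖) * (|(n : ℝ)| ^ s.re)⁻¹ * (|(n : ℝ)| ^ a)⁻¹ =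
        ‖χ (n : ZMod m)‖ * (|(n : ℝ)| ^ s.re)⁻¹ := by
        have : |(n : ℝ)| ^ a ≠ 0 := by positivity
        field_simp
      rw [h2]
      exact mul_le_of_le_one_left (by positivity) h1
  -- Fold n with -n: n^a χ(n) is even in n, which produces the factor 2, and n^a against |n|^(-s-a)
  -- leaves n^(-s).
  have h1 := (hasSum_mellin_pi_mul_sq hpos hF hsum).nat_add_neg
  have h2 := ((DirichletCharacter.LSeriesSummable_of_one_lt_re χ hs).LSeriesHasSum.mul_left
    (Complex.Gammaℝ (s + a))).mul_left (2 : ℂ)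
  rw [← DirichletCharacter.LFunction_eq_LSeries χ hs] at h2
  simp only [Int.cast_zero, h0, mul_zero, zero_div, add_zero] at h1
  refine h1.unique (h2.congr_fun fun n => ?_)
  rcases eq_or_ne n 0 with rfl | hn
  · simp [h0]
  · have hnc : (n : ℂ) ≠ 0 := by exact_mod_cast hn
    have hsymm : ((-(n : ℤ) : ℤ) : ℂ) ^ a * χ ((-(n : ℤ) : ℤ) : ZMod m) =
        (n : ℂ) ^ a * χ (n : ZMod m) := by
      push_cast
      rw [← neg_one_mul (n : ZMod m), map_mul, neg_pow]
      rcases parity_cases χ with ⟨h, h'⟩ | ⟨h, h'⟩ <;> rw [ha, h, h'] <;> ring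
    rw [hsymm, LSeries.term_of_ne_zero hn]
    push_cast
    simp only [abs_neg, Nat.abs_cast, Complex.ofReal_natCast]
    rw [Complex.cpow_add _ _ hnc, Complex.cpow_natCast]
    have h3 : (n : ℂ) ^ a ≠ 0 := pow_ne_zero _ hnc
    have h4 : (n : ℂ) ^ s ≠ 0 := by simp [Complex.cpow_eq_zero_iff, hnc]
    field_simp
    ring

theorem phiTransform_eq_mellin (hreal : ∀ x : ZMod m, (χ x).im = 0) (z : ℂ) :
    phiTransform χ z = (m : ℂ) ^ ((1 + 2 * (parity χ : ℂ) + 2 * Complex.I * z) / 4) *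
      (mellin (theta χ) ((1 + 2 * (parity χ : ℂ) + 2 * Complex.I * z) / 4) / 2) := by
  set w := (1 + 2 * (parity χ : ℂ) + 2 * Complex.I * z) / 4 with hw
  have hm : (0 : ℝ) < m := by exact_mod_cast NeZero.pos m
  have hcomp := mellin_comp_mul_left (theta χ) w (inv_pos.mpr hm)
  have hcpow : (((m : ℝ)⁻¹ : ℝ) : ℂ) ^ (-w) = (m : ℂ) ^ w := by
    rw [Complex.cpow_neg, Complex.ofReal_inv, Complex.inv_cpow, inv_inv, Complex.ofReal_natCast]
    rw [Complex.ofReal_natCast, Complex.natCast_arg]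
    exact Real.pi_pos.ne
  rw [hcpow, smul_eq_mul] at hcomp
  rw [← mul_div_assoc, ← hcomp, mellin_eq_integral_exp]
  have hsub := Measure.integral_comp_mul_left
    (fun u : ℝ => Complex.exp (-w * u) * theta χ ((m : ℝ)⁻¹ * Real.exp (-u))) 2
  have : (∫ u : ℝ, Complex.exp (-w * u) * theta χ ((m : ℝ)⁻¹ * Real.exp (-u))) / 2 =
      ∫ t : ℝ, Complex.exp (-w * ((2 * t : ℝ) : ℂ)) *
        theta χ ((m : ℝ)⁻¹ * Real.exp (-(2 * t))) := by
    rw [hsub, abs_of_pos (by norm_num), Complex.real_smul]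
    push_cast
    ring
  rw [this, phiTransform]
  congr 1
  ext t
  rw [ofReal_phi hreal, ← mul_assoc, Complex.ofReal_exp, ← Complex.exp_add,
    div_eq_inv_mul (Real.exp _)]
  congr 2
  rw [hw]
  push_cast
  ring

theorem differentiable_Xi (hχ : χ ≠ 1) : Differentiable ℂ (Xi χ) := by
  have hm : (m : ℂ) ≠ 0 := by exact_mod_cast NeZero.ne m
  refine Differentiable.mul ?_ ?_
  · refine Differentiable.const_cpow (by fun_prop) (Or.inl hm)
  · exact (DirichletCharacter.differentiable_completedLFunction hχ).comp (by fun_prop)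

theorem completedLFunction_eq (hχ : χ ≠ 1) {s : ℂ} (hs : 0 < s.re) :
    DirichletCharacter.completedLFunction χ s =
      Complex.Gammaℝ (s + parity χ) * DirichletCharacter.LFunction χ s := by
  have hg : DirichletCharacter.gammaFactor χ s = Complex.Gammaℝ (s + parity χ) := by
    rcases parity_cases χ with ⟨h, h'⟩ | ⟨h, h'⟩
    · rw [h, DirichletCharacter.Even.gammaFactor_def h', Nat.cast_zero, add_zero]
    · rw [h, DirichletCharacter.Odd.gammaFactor_def h', Nat.cast_one]
  have hg0 : Complex.Gammaℝ (s + parity χ) ≠ 0 :=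
    Complex.Gammaℝ_ne_zero_of_re_pos (by simp; positivity)
  rw [DirichletCharacter.LFunction_eq_completed_div_gammaFactor χ s (Or.inr (level_ne_one hχ)), hg]
  field_simp

theorem Xi_eq_phiTransform (hχ : χ ≠ 1) (hreal : ∀ x : ZMod m, (χ x).im = 0) :
    Xi χ = phiTransform χ := by
  -- Identity theorem. The point z = -i corresponds to s = 3/2, and Im z < -1/2 to Re s > 1, where
  -- the Dirichlet series converges.
  refine AnalyticOnNhd.eq_of_eventuallyEq (𝕜 := ℂ) (z₀ := -Complex.I)
    (fun z _ => (differentiable_Xi hχ).analyticAt z)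
    (fun z _ => (differentiable_phiTransform hχ hreal).analyticAt z) ?_
  have hopen : ∀ᶠ z : ℂ in 𝓝 (-Complex.I), z.im < -(1 / 2) :=
    Complex.continuous_im.continuousAt.eventually_lt_const (by norm_num)
  filter_upwards [hopen] with z hz
  have hs : 1 < ((1 + 2 * Complex.I * z) / 2).re := by
    rw [show (1 + 2 * Complex.I * z) / 2 = 1 / 2 + Complex.I * z by ring]
    simp
    linarith
  rw [phiTransform_eq_mellin hreal, Xi]
  congr 1
  have h1 := mellin_theta hχ hs
  rw [show ((1 + 2 * Complex.I * z) / 2 + (parity χ : ℂ)) / 2 =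
    (1 + 2 * (parity χ : ℂ) + 2 * Complex.I * z) / 4 by ring] at h1
  rw [h1, completedLFunction_eq hχ (by linarith)]
  ring

end RealCharXi

/-! ### Consequences of positivity: evenness, the function of w = z², and its zeros. -/

namespace RealCharXi

open Filter Topology Set MeasureTheory

variable {m : ℕ} {χ : DirichletCharacter ℂ m}

theorem inv_eq_self (hreal : ∀ x : ZMod m, (χ x).im = 0) : χ⁻¹ = χ := by
  rw [← MulChar.star_eq_inv]
  ext x
  rw [MulChar.star_apply, RCLike.star_def]
  exact Complex.conj_eq_iff_im.mpr (hreal x)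

variable [NeZero m]

theorem exists_Xi_ne_zero (hχ : χ ≠ 1) : ∃ z, Xi χ z ≠ 0 := by
  by_contra! h
  have hm : (m : ℂ) ≠ 0 := by exact_mod_cast NeZero.ne m
  have h1 := h (-(3 / 2) * Complex.I)
  rw [Xi, mul_eq_zero, Complex.cpow_eq_zero_iff] at h1
  have h2 := h1.resolve_left fun h => hm h.1
  rw [show (1 + 2 * Complex.I * (-(3 / 2) * Complex.I)) / 2 = 2 by
    linear_combination (-(3 / 2) : ℂ) * Complex.I_mul_I] at h2
  have h3 := DirichletCharacter.LFunction_ne_zero_of_one_le_re χ (s := 2) (Or.inl hχ) (by simp)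
  rw [DirichletCharacter.LFunction_eq_completed_div_gammaFactor χ 2 (Or.inl two_ne_zero), h2,
    zero_div] at h3
  exact h3 rfl

theorem exists_phi_ne_zero (hχ : χ ≠ 1) (hreal : ∀ x : ZMod m, (χ x).im = 0) :
    ∃ t, phi χ t ≠ 0 := by
  by_contra! h
  obtain ⟨z, hz⟩ := exists_Xi_ne_zero hχ
  rw [Xi_eq_phiTransform hχ hreal, phiTransform] at hz
  simp [h] at hz

theorem integral_mul_phi_pos (hχ : χ ≠ 1) (hreal : ∀ x : ZMod m, (χ x).im = 0)
    (hphi : ∀ t : ℝ, 0 ≤ phi χ t) {g : ℝ → ℝ} (hg : Continuous g) (hg0 : ∀ t, 0 ≤ g t)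
    (hgpos : ∀ t, t ≠ 0 → 0 < g t) (hint : Integrable fun t => g t * phi χ t) :
    0 < ∫ t, g t * phi χ t := by
  have hnn : ∀ t, 0 ≤ g t * phi χ t := fun t => mul_nonneg (hg0 t) (hphi t)
  refine lt_of_le_of_ne (integral_nonneg hnn) fun h0 => ?_
  have hcont := continuous_phi hreal
  have h1 := (integral_eq_zero_iff_of_nonneg hnn hint).mp h0.symm
  have h2 := (Continuous.ae_eq_iff_eq volume (hg.mul hcont) continuous_const).mp h1
  have h3 : ∀ t ∈ ({0}ᶜ : Set ℝ), phi χ t = 0 := fun t ht =>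
    (mul_eq_zero.mp (congrFun h2 t)).resolve_left (hgpos t ht).ne'
  have h4 : phi χ = fun _ => 0 :=
    Continuous.ext_on (dense_compl_singleton (0 : ℝ)) hcont continuous_const h3
  obtain ⟨t, ht⟩ := exists_phi_ne_zero hχ hreal
  exact ht (congrFun h4 t)

theorem b_even_pos (hχ : χ ≠ 1) (hreal : ∀ x : ZMod m, (χ x).im = 0)
    (hphi : ∀ t : ℝ, 0 ≤ phi χ t) (n : ℕ) : 0 < b χ (2 * n) := by
  refine integral_mul_phi_pos hχ hreal hphi (continuous_pow _) (fun t => ?_) (fun t ht => ?_)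
    (integrable_pow_mul_phi hχ hreal _)
  · exact (even_two_mul n).pow_nonneg t
  · exact (even_two_mul n).pow_pos ht

theorem b_zero_pos (hχ : χ ≠ 1) (hreal : ∀ x : ZMod m, (χ x).im = 0)
    (hphi : ∀ t : ℝ, 0 ≤ phi χ t) : 0 < b χ 0 :=
  b_even_pos hχ hreal hphi 0

theorem Xi_zero (hχ : χ ≠ 1) (hreal : ∀ x : ZMod m, (χ x).im = 0) : Xi χ 0 = b χ 0 := by
  rw [Xi_eq_phiTransform hχ hreal, phiTransform, b, ← integral_complex_ofReal]
  simp

theorem Xi_zero_ne_zero (hχ : χ ≠ 1) (hreal : ∀ x : ZMod m, (χ x).im = 0)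
    (hphi : ∀ t : ℝ, 0 ≤ phi χ t) : Xi χ 0 ≠ 0 := by
  rw [Xi_zero hχ hreal]
  exact_mod_cast (b_zero_pos hχ hreal hphi).ne'

/-- On the imaginary axis the transform is the integral of a positive exponential against a
nonnegative, not identically zero kernel. Hence each pair ±z of zeros has exactly one member in the
right half plane. -/
theorem Xi_ne_zero_of_re_eq_zero (hχ : χ ≠ 1) (hreal : ∀ x : ZMod m, (χ x).im = 0)
    (hphi : ∀ t : ℝ, 0 ≤ phi χ t) {z : ℂ} (hz : z.re = 0) : Xi χ z ≠ 0 := by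
  have hpos : 0 < ∫ t, Real.exp (z.im * t) * phi χ t := by
    refine integral_mul_phi_pos hχ hreal hphi (by fun_prop) (fun t => (Real.exp_pos _).le)
      (fun t _ => Real.exp_pos _) ?_
    refine (integrable_exp_mul_abs_phi hχ hreal (abs_nonneg z.im)).mono' ?_
      (Eventually.of_forall fun t => ?_)
    · exact ((by fun_prop : Continuous fun t : ℝ => Real.exp (z.im * t)).mul
        (continuous_phi hreal)).aestronglyMeasurable
    · rw [norm_mul, Real.norm_eq_abs, Real.abs_exp, Real.norm_eq_abs, ← abs_mul]
      gcongr
      exact le_abs_self _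
  have hzI : z = z.im * Complex.I := Complex.ext (by simp [hz]) (by simp)
  rw [Xi_eq_phiTransform hχ hreal, phiTransform]
  have : ∀ t : ℝ, Complex.exp (-(Complex.I * z * t)) * (phi χ t : ℂ) =
      ((Real.exp (z.im * t) * phi χ t : ℝ) : ℂ) := fun t => by
    rw [hzI]
    push_cast
    congr 2
    simp
    linear_combination (-(z.im : ℂ) * t) * Complex.I_mul_I
  simp only [this]
  rw [integral_complex_ofReal]
  exact_mod_cast hpos.ne'

/-- The functional equation gives Ξ(-z) = εΞ(z) with ε the root number; evaluating at z = 0, where Ξ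
does not vanish, gives ε = 1 without computing a Gauss sum. -/
theorem Xi_neg (hprim : χ.IsPrimitive) (hχ : χ ≠ 1) (hreal : ∀ x : ZMod m, (χ x).im = 0)
    (hphi : ∀ t : ℝ, 0 ≤ phi χ t) (z : ℂ) : Xi χ (-z) = Xi χ z := by
  have hm : (m : ℂ) ≠ 0 := by exact_mod_cast NeZero.ne m
  have hroot : ∀ z, Xi χ (-z) = DirichletCharacter.rootNumber χ * Xi χ z := fun z => by
    have h1 := hprim.completedLFunction_one_sub ((1 + 2 * Complex.I * z) / 2)
    rw [inv_eq_self hreal] at h1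
    rw [Xi, Xi, show (1 + 2 * Complex.I * -z) / 2 = 1 - (1 + 2 * Complex.I * z) / 2 by ring, h1,
      show (1 + 2 * (parity χ : ℂ) + 2 * Complex.I * z) / 4 =
        (1 + 2 * (parity χ : ℂ) + 2 * Complex.I * -z) / 4 +
          ((1 + 2 * Complex.I * z) / 2 - 1 / 2) by ring, Complex.cpow_add _ _ hm]
    ring
  have h0 := hroot 0
  rw [neg_zero] at h0
  rw [hroot, mul_right_cancel₀ (Xi_zero_ne_zero hχ hreal hphi)
    ((one_mul _).trans h0 : 1 * Xi χ 0 = _) |>.symm, one_mul]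

/-- The normalised entire function `w ↦ Ξ(√w) / Ξ(0)`. -/
noncomputable def xiSqrt (χ : DirichletCharacter ℂ m) (w : ℂ) : ℂ :=
  Xi χ (w ^ (1 / 2 : ℂ)) / Xi χ 0

/-- The Taylor coefficients of `xiSqrt`. -/
noncomputable def xiCoeff (χ : DirichletCharacter ℂ m) (n : ℕ) : ℂ :=
  (-1) ^ n * b χ (2 * n) / ((2 * n).factorial * b χ 0)

theorem cpow_half_sq (w : ℂ) : (w ^ (1 / 2 : ℂ)) ^ 2 = w := by
  rw [one_div]
  exact Complex.cpow_nat_inv_pow w two_ne_zero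

theorem hasSum_Xi_sq (hprim : χ.IsPrimitive) (hχ : χ ≠ 1)
    (hreal : ∀ x : ZMod m, (χ x).im = 0) (hphi : ∀ t : ℝ, 0 ≤ phi χ t) (z : ℂ) :
    HasSum (fun n : ℕ => xiCoeff χ n * (z ^ 2) ^ n) (Xi χ z / Xi χ 0) := by
  have h1 := fun z => hasSum_phiTransform hχ hreal z
  simp only [← Xi_eq_phiTransform hχ hreal] at h1
  -- Averaging the series at z and -z removes the odd moments.
  have h2 := ((h1 z).add (h1 (-z))).div_const (2 * Xi χ 0)
  rw [Xi_neg hprim hχ hreal hphi, ← two_mul, mul_div_mul_left _ _ two_ne_zero] at h2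
  have hinj : Function.Injective fun n : ℕ => 2 * n := fun a b h => by simpa using h
  rw [← hinj.hasSum_iff] at h2
  · refine h2.congr_fun fun n => ?_
    simp only [Function.comp_apply, xiCoeff]
    rw [pow_mul (-z), neg_sq, ← pow_mul, pow_mul (-Complex.I), neg_sq, Complex.I_sq,
      Xi_zero hχ hreal]
    have : ((b χ 0 : ℝ) : ℂ) ≠ 0 := by exact_mod_cast (b_zero_pos hχ hreal hphi).ne'
    have : ((2 * n).factorial : ℂ) ≠ 0 := by exact_mod_cast Nat.factorial_ne_zero _
    field_simp
    ring
  · intro n hn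
    have hodd : Odd n := by
      rw [← Nat.not_even_iff_odd]
      rintro ⟨k, rfl⟩
      exact hn ⟨k, by ring⟩
    rw [hodd.neg_pow z, mul_neg, add_neg_cancel, zero_div]

theorem hasSum_xiSqrt (hprim : χ.IsPrimitive) (hχ : χ ≠ 1)
    (hreal : ∀ x : ZMod m, (χ x).im = 0) (hphi : ∀ t : ℝ, 0 ≤ phi χ t) (w : ℂ) :
    HasSum (fun n : ℕ => xiCoeff χ n * w ^ n) (xiSqrt χ w) := by
  have := hasSum_Xi_sq hprim hχ hreal hphi (w ^ (1 / 2 : ℂ))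
  rwa [cpow_half_sq] at this

theorem xiSqrt_sq (hprim : χ.IsPrimitive) (hχ : χ ≠ 1)
    (hreal : ∀ x : ZMod m, (χ x).im = 0) (hphi : ∀ t : ℝ, 0 ≤ phi χ t) (z : ℂ) :
    xiSqrt χ (z ^ 2) = Xi χ z / Xi χ 0 :=
  (hasSum_xiSqrt hprim hχ hreal hphi (z ^ 2)).unique (hasSum_Xi_sq hprim hχ hreal hphi z)

theorem differentiable_xiSqrt (hprim : χ.IsPrimitive) (hχ : χ ≠ 1)
    (hreal : ∀ x : ZMod m, (χ x).im = 0) (hphi : ∀ t : ℝ, 0 ≤ phi χ t) :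
    Differentiable ℂ (xiSqrt χ) := by
  have := (hasFPowerSeriesOnBall_of_hasSum
    (hasSum_xiSqrt hprim hχ hreal hphi)).differentiableOn
  rwa [Metric.eball_top, differentiableOn_univ] at this

theorem xiSqrt_zero (hχ : χ ≠ 1) (hreal : ∀ x : ZMod m, (χ x).im = 0)
    (hphi : ∀ t : ℝ, 0 ≤ phi χ t) : xiSqrt χ 0 = 1 := by
  rw [xiSqrt, Complex.zero_cpow (by norm_num)]
  exact div_self (Xi_zero_ne_zero hχ hreal hphi)

theorem exists_norm_xiSqrt_le (hχ : χ ≠ 1) (hreal : ∀ x : ZMod m, (χ x).im = 0)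
    (hphi : ∀ t : ℝ, 0 ≤ phi χ t) :
    ∃ C : ℝ, ∀ w, ‖xiSqrt χ w‖ ≤ Real.exp (C + ‖w‖ ^ (2 / 3 : ℝ)) := by
  set J := ∫ t : ℝ, ‖Real.exp (t ^ 4) * phi χ t‖
  have hle := norm_phiTransform_le hχ hreal
  rw [← Xi_eq_phiTransform hχ hreal] at hle
  have h0 : 0 < ‖Xi χ 0‖ := norm_pos_iff.mpr (Xi_zero_ne_zero hχ hreal hphi)
  have hJ : 0 < J := by
    have := hle 0
    rw [norm_zero, Real.zero_rpow (by norm_num), Real.exp_zero, one_mul] at this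
    linarith
  refine ⟨Real.log (J / ‖Xi χ 0‖), fun w => ?_⟩
  rw [Real.exp_add, Real.exp_log (by positivity), xiSqrt, norm_div, div_mul_eq_mul_div]
  gcongr
  refine (hle _).trans_eq ?_
  have h1 : ‖w ^ (1 / 2 : ℂ)‖ ^ (4 / 3 : ℝ) = ‖w‖ ^ (2 / 3 : ℝ) := by
    conv_rhs => rw [← cpow_half_sq w, norm_pow, ← Real.rpow_natCast,
      ← Real.rpow_mul (norm_nonneg _)]
    norm_num
  rw [h1, mul_comm]

/-- `z` lists the zeros of `Ξ(·, χ)` in the right half plane with their multiplicities; the index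
type is arbitrary. -/
structure IsZeroFamily {ι : Type*} (χ : DirichletCharacter ℂ m) (z : ι → ℂ) : Prop where
  re_pos : ∀ k, 0 < (z k).re
  isZero : ∀ k, Xi χ (z k) = 0
  multiplicity : ∀ w : ℂ, 0 < w.re → Xi χ w = 0 →
    {k | z k = w}.encard = analyticOrderAt (Xi χ) w

theorem IsZeroList.isZeroFamily {z : ℕ → ℂ} (h : IsZeroList χ z) : IsZeroFamily χ z :=
  ⟨h.re_pos, h.isZero, h.multiplicity⟩

/-- Squaring is a local biholomorphism away from 0, so it preserves multiplicities. -/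
theorem analyticOrderAt_xiSqrt_sq (hprim : χ.IsPrimitive) (hχ : χ ≠ 1)
    (hreal : ∀ x : ZMod m, (χ x).im = 0) (hphi : ∀ t : ℝ, 0 ≤ phi χ t) {z : ℂ} (hz : z ≠ 0) :
    analyticOrderAt (xiSqrt χ) (z ^ 2) = analyticOrderAt (Xi χ) z := by
  have h0 := Xi_zero_ne_zero hχ hreal hphi
  have h1 : analyticOrderAt (xiSqrt χ ∘ fun u : ℂ => u ^ 2) z = analyticOrderAt (xiSqrt χ) (z ^ 2) :=
    analyticOrderAt_comp_of_deriv_ne_zero (by fun_prop) (by simpa using hz)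
  rw [← h1, show xiSqrt χ ∘ (fun u : ℂ => u ^ 2) = (fun _ => (Xi χ 0)⁻¹) * Xi χ by
    ext u
    simp [xiSqrt_sq hprim hχ hreal hphi, div_eq_inv_mul],
    analyticOrderAt_mul analyticAt_const ((differentiable_Xi hχ).analyticAt z),
    analyticAt_const.analyticOrderAt_eq_zero.mpr (inv_ne_zero h0), zero_add]

theorem IsZeroFamily.exists_zeroFamily {ι : Type*} {z : ι → ℂ} (H : IsZeroFamily χ z)
    (hprim : χ.IsPrimitive) (hχ : χ ≠ 1) (hreal : ∀ x : ZMod m, (χ x).im = 0)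
    (hphi : ∀ t : ℝ, 0 ≤ phi χ t) :
    ∃ C, EntirePowerSum.ZeroFamily (xiSqrt χ) (fun i => z i ^ 2) C (2 / 3) := by
  obtain ⟨C, hC⟩ := exists_norm_xiSqrt_le hχ hreal hphi
  refine ⟨C, differentiable_xiSqrt hprim hχ hreal hphi, xiSqrt_zero hχ hreal hphi, fun w => ?_,
    by norm_num, by norm_num, hC⟩
  set u := w ^ (1 / 2 : ℂ) with hu
  have huw : u ^ 2 = w := cpow_half_sq w
  have hre : 0 ≤ u.re := by
    rcases eq_or_ne w 0 with h | h
    · rw [hu, h, Complex.zero_cpow (by norm_num), Complex.zero_re]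
    · rw [hu, Complex.cpow_def_of_ne_zero h, Complex.exp_re]
      refine mul_nonneg (Real.exp_pos _).le (Real.cos_nonneg_of_mem_Icc ?_)
      have h1 := Complex.neg_pi_lt_arg w
      have h2 := Complex.arg_le_pi w
      have h3 : (Complex.log w * (1 / 2)).im = w.arg / 2 := by
        rw [Complex.mul_im, Complex.log_im]
        simp
        ring
      rw [h3]
      constructor <;> linarith
  -- The principal root has Re u ≥ 0 while Re z_i > 0, so z_i = -u is impossible.
  have hsq : ∀ i, z i ^ 2 = w → z i = u := by
    intro i hi
    rw [← huw, sq_eq_sq_iff_eq_or_eq_neg] at hi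
    rcases hi with hi | hi
    · exact hi
    · have h1 := H.re_pos i
      rw [hi, Complex.neg_re] at h1
      linarith
  have hset : {i | z i ^ 2 = w} = {i | z i = u} := by
    ext i
    exact ⟨hsq i, fun h => by rw [Set.mem_ofPred_eq] at h ⊢; rw [h, huw]⟩
  by_cases hX : Xi χ u = 0
  · have hne : u.re ≠ 0 := fun h => Xi_ne_zero_of_re_eq_zero hχ hreal hphi h hX
    have hpos : 0 < u.re := lt_of_le_of_ne hre hne.symm
    have hu0 : u ≠ 0 := fun h => hne (by rw [h, Complex.zero_re])
    rw [hset, H.multiplicity u hpos hX, ← huw, analyticOrderAt_xiSqrt_sq hprim hχ hreal hphi hu0]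
  · have hempty : {i | z i ^ 2 = w} = ∅ := by
      rw [hset, Set.eq_empty_iff_forall_notMem]
      intro i hi
      rw [Set.mem_ofPred_eq] at hi
      exact hX (hi ▸ H.isZero i)
    rw [hempty, Set.encard_empty, eq_comm]
    refine ((differentiable_xiSqrt hprim hχ hreal hphi).analyticAt w).analyticOrderAt_eq_zero.mpr ?_
    rw [← huw, xiSqrt_sq hprim hχ hreal hphi]
    exact div_ne_zero hX (Xi_zero_ne_zero hχ hreal hphi)

end RealCharXi

/-! ### Complete monotonicity in terms of the moments. -/

namespace HausdorffMoment

open Filter Topology Set MeasureTheory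

variable {ι : Type*} {x : ι → ℂ}

theorem summable_pow_mul_pow (hx : Summable fun i => ‖x i‖) (k j : ℕ) :
    Summable fun i => x i ^ (k + 1) * (x i - 1) ^ j := by
  refine (summable_mul_aeval hx (Polynomial.X ^ k * (Polynomial.X - 1) ^ j)).congr fun i => ?_
  simp
  ring

/-- Differencing in k multiplies each term x^(k+1) by x - 1. -/
theorem iterate_fwdDiff_tsum_pow (hx : Summable fun i => ‖x i‖) (j : ℕ) :
    (fwdDiff 1)^[j] (fun k : ℕ => ∑' i, x i ^ (k + 1)) =
      fun k => ∑' i, x i ^ (k + 1) * (x i - 1) ^ j := by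
  induction j with
  | zero => simp
  | succ j ih =>
    rw [Function.iterate_succ_apply', ih]
    ext k
    rw [fwdDiff, ← (summable_pow_mul_pow hx (k + 1) j).tsum_sub (summable_pow_mul_pow hx k j)]
    exact tsum_congr fun i => by ring

theorem neg_one_pow_mul_iterate_fwdDiff (hx : Summable fun i => ‖x i‖) (j k : ℕ) :
    (-1 : ℂ) ^ j * (fwdDiff 1)^[j] (fun k : ℕ => ∑' i, x i ^ (k + 1)) k =
      ∑' i, x i ^ (k + 1) * (1 - x i) ^ j := by
  rw [iterate_fwdDiff_tsum_pow hx, ← tsum_mul_left]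
  refine tsum_congr fun i => ?_
  rw [← neg_sub (x i) 1, neg_pow (x i - 1)]
  ring

/-- The power moments of an absolutely summable family of complex numbers of modulus at most one
are completely monotone if and only if all the numbers are real and nonnegative. -/
theorem isCompletelyMonotone_iff (hx : Summable fun i => ‖x i‖) (hx1 : ∀ i, ‖x i‖ ≤ 1) :
    RealCharXi.IsCompletelyMonotone (fun k : ℕ => ∑' i, x i ^ (k + 1)) ↔ ∀ i, 0 ≤ x i := by
  constructor
  · intro h
    refine nonneg_of_moments hx fun k l => ?_
    have := h l k
    rw [neg_one_pow_mul_iterate_fwdDiff hx] at this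
    exact (Complex.le_def.mp this).1
  · intro h j k
    rw [neg_one_pow_mul_iterate_fwdDiff hx]
    have hr : ∀ i, x i = ((x i).re : ℂ) := fun i =>
      Complex.ext rfl (by simpa using (Complex.le_def.mp (h i)).2.symm)
    have h1 : ∀ i, x i ^ (k + 1) * (1 - x i) ^ j =
        (((x i).re ^ (k + 1) * (1 - (x i).re) ^ j : ℝ) : ℂ) := fun i => by
      conv_lhs => rw [hr i]
      push_cast
      ring
    simp only [h1]
    rw [← Complex.ofReal_tsum]
    refine Complex.zero_le_real.mpr (tsum_nonneg fun i => ?_)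
    have h2 : 0 ≤ (x i).re := (Complex.le_def.mp (h i)).1
    have h3 : (x i).re ≤ 1 := (Complex.re_le_norm _).trans (hx1 i)
    have h4 : 0 ≤ 1 - (x i).re := by linarith
    positivity

end HausdorffMoment

/-! ### Power sums of the zeros, existence of the zero list, and GRH. -/

namespace RealCharXi

open Filter Topology Set MeasureTheory

variable {m : ℕ} [NeZero m] {χ : DirichletCharacter ℂ m}

section Family

variable {ι : Type*} {z : ι → ℂ}

theorem IsZeroFamily.ne_zero (H : IsZeroFamily χ z) (i : ι) : z i ≠ 0 := fun h => by
  have := H.re_pos i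
  rw [h, Complex.zero_re] at this
  exact lt_irrefl _ this

theorem IsZeroFamily.summable_norm_inv_sq (H : IsZeroFamily χ z) (hprim : χ.IsPrimitive) (hχ : χ ≠ 1)
    (hreal : ∀ x : ZMod m, (χ x).im = 0) (hphi : ∀ t : ℝ, 0 ≤ phi χ t) : Summable fun i => (‖z i‖ ^ 2)⁻¹ := by
  obtain ⟨C, hC⟩ := H.exists_zeroFamily hprim hχ hreal hphi
  simpa only [norm_pow] using hC.summable_norm_inv

theorem IsZeroFamily.summable_pow (H : IsZeroFamily χ z) (hprim : χ.IsPrimitive) (hχ : χ ≠ 1)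
    (hreal : ∀ x : ZMod m, (χ x).im = 0) (hphi : ∀ t : ℝ, 0 ≤ phi χ t)
    (n : ℕ) : Summable fun i => 1 / z i ^ (2 * (n + 1)) := by
  obtain ⟨C, hC⟩ := H.exists_zeroFamily hprim hχ hreal hphi
  simpa only [← pow_mul] using hC.summable_pow n

theorem IsZeroFamily.factorial_mul_tsum (H : IsZeroFamily χ z) (hprim : χ.IsPrimitive) (hχ : χ ≠ 1)
    (hreal : ∀ x : ZMod m, (χ x).im = 0) (hphi : ∀ t : ℝ, 0 ≤ phi χ t)
    (n : ℕ) :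
    (n.factorial : ℂ) * ∑' i, 1 / z i ^ (2 * (n + 1)) =
      -iteratedDeriv (n + 1) (fun w => Complex.log (xiSqrt χ w)) 0 := by
  obtain ⟨C, hC⟩ := H.exists_zeroFamily hprim hχ hreal hphi
  simpa only [← pow_mul] using hC.tsum_eq n

theorem IsZeroFamily.tsum_recurrence (H : IsZeroFamily χ z) (hprim : χ.IsPrimitive) (hχ : χ ≠ 1)
    (hreal : ∀ x : ZMod m, (χ x).im = 0) (hphi : ∀ t : ℝ, 0 ≤ phi χ t)
    (k : ℕ) :
    ∑' i, 1 / z i ^ (2 * (k + 1)) = -((k + 1) * xiCoeff χ (k + 1)) -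
      ∑ j ∈ Finset.range k, (∑' i, 1 / z i ^ (2 * (j + 1))) * xiCoeff χ (k - j) := by
  have hder := iteratedDeriv_of_hasSum (hasSum_xiSqrt hprim hχ hreal hphi)
  have h0 := xiSqrt_zero hχ hreal hphi
  have h1 := NewtonSeries.iteratedDeriv_log_recurrence
    ((differentiable_xiSqrt hprim hχ hreal hphi).analyticAt 0) h0 k
  have hf : ∀ n : ℕ, (n.factorial : ℂ) ≠ 0 := fun n => by exact_mod_cast n.factorial_ne_zero
  have h2 : ∀ j, iteratedDeriv (j + 1) (fun w => Complex.log (xiSqrt χ w)) 0 / (j.factorial : ℂ) =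
      -∑' i, 1 / z i ^ (2 * (j + 1)) := fun j => by
    rw [div_eq_iff (hf j)]
    linear_combination H.factorial_mul_tsum hprim hχ hreal hphi j
  have hc0 : xiCoeff χ 0 = 1 := by
    have := hder 0
    rw [iteratedDeriv_zero, h0] at this
    simpa using this.symm
  simp only [h2, hder, mul_div_cancel_left₀ _ (hf _)] at h1
  rw [Nat.factorial_succ, Finset.sum_range_succ, Nat.sub_self, hc0] at h1
  push_cast at h1
  have h3 : ((k : ℂ) + 1) * k.factorial * xiCoeff χ (k + 1) / k.factorial =
      (k + 1) * xiCoeff χ (k + 1) := by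
    field_simp [hf k]
  rw [h3] at h1
  simp only [neg_mul, Finset.sum_neg_distrib] at h1
  linear_combination h1

/-- With finitely many zeros almost all Taylor coefficients of `xiSqrt χ` would vanish, but up to
sign they are positive multiples of the positive even moments. -/
theorem IsZeroFamily.infinite (H : IsZeroFamily χ z) (hprim : χ.IsPrimitive) (hχ : χ ≠ 1)
    (hreal : ∀ x : ZMod m, (χ x).im = 0) (hphi : ∀ t : ℝ, 0 ≤ phi χ t) : Infinite ι := by
  by_contra hfin
  rw [not_infinite_iff_finite] at hfin
  have := Fintype.ofFinite ι
  obtain ⟨C, hC⟩ := H.exists_zeroFamily hprim hχ hreal hphi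
  have h1 := hC.iteratedDeriv_eq_zero_of_card_lt (Nat.lt_succ_self _)
  rw [iteratedDeriv_of_hasSum (hasSum_xiSqrt hprim hχ hreal hphi)] at h1
  have hb : ∀ n, ((b χ (2 * n) : ℝ) : ℂ) ≠ 0 := fun n => by
    exact_mod_cast (b_even_pos hχ hreal hphi n).ne'
  have hf : ∀ n : ℕ, (n.factorial : ℂ) ≠ 0 := fun n => by exact_mod_cast n.factorial_ne_zero
  refine mul_ne_zero (hf _) ?_ h1
  exact div_ne_zero (mul_ne_zero (pow_ne_zero _ (by norm_num)) (hb _))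
    (mul_ne_zero (hf _) (hb 0))

theorem IsZeroFamily.countable (H : IsZeroFamily χ z) (hprim : χ.IsPrimitive) (hχ : χ ≠ 1)
    (hreal : ∀ x : ZMod m, (χ x).im = 0) (hphi : ∀ t : ℝ, 0 ≤ phi χ t) : Countable ι := by
  have h := (H.summable_norm_inv_sq hprim hχ hreal hphi).countable_support
  have huniv : Function.support (fun i => (‖z i‖ ^ 2)⁻¹) = Set.univ := by
    rw [Set.eq_univ_iff_forall]
    intro i
    rw [Function.mem_support]
    exact inv_ne_zero (pow_ne_zero _ (norm_ne_zero_iff.mpr (H.ne_zero i)))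
  rw [huniv] at h
  exact Set.countable_univ_iff.mp h

/-- Apply the moment criterion to x_i = 1/(λ z_i²), of modulus at most 1 by the choice of λ. As Re
z_i > 0, the number z_i² is real only if z_i is. -/
theorem IsZeroFamily.isCompletelyMonotone_iff (H : IsZeroFamily χ z) (hprim : χ.IsPrimitive) (hχ : χ ≠ 1)
    (hreal : ∀ x : ZMod m, (χ x).im = 0) (hphi : ∀ t : ℝ, 0 ≤ phi χ t)
    {lam : ℝ} (hlam0 : 0 < lam)
    (hlam : ∀ i, 1 / ‖z i‖ ^ 2 ≤ lam) :
    IsCompletelyMonotone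
      (fun k : ℕ => (∑' i, 1 / z i ^ (2 * (k + 1))) / (lam : ℂ) ^ (k + 1)) ↔
      ∀ i, (z i).im = 0 := by
  set x : ι → ℂ := fun i => (lam * z i ^ 2)⁻¹ with hx
  have hnorm : ∀ i, ‖x i‖ = lam⁻¹ * (‖z i‖ ^ 2)⁻¹ := fun i => by
    simp [hx, abs_of_pos hlam0, mul_comm]
  have hsum : Summable fun i => ‖x i‖ := by
    simp only [hnorm]
    exact (H.summable_norm_inv_sq hprim hχ hreal hphi).mul_left _
  have hle : ∀ i, ‖x i‖ ≤ 1 := fun i => by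
    rw [hnorm, inv_mul_le_iff₀ hlam0, mul_one, ← one_div]
    exact hlam i
  have hfun : (fun k : ℕ => (∑' i, 1 / z i ^ (2 * (k + 1))) / (lam : ℂ) ^ (k + 1)) =
      fun k : ℕ => ∑' i, x i ^ (k + 1) := by
    ext k
    rw [← tsum_div_const]
    refine tsum_congr fun i => ?_
    rw [hx, inv_pow, mul_pow, ← pow_mul, one_div, mul_inv, div_eq_mul_inv, mul_comm]
  rw [hfun, HausdorffMoment.isCompletelyMonotone_iff hsum hle]
  refine forall_congr' fun i => ⟨fun h => ?_, fun h => ?_⟩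
  · have him : (x i)⁻¹.im = 0 := by
      rw [Complex.inv_im, ← (Complex.le_def.mp h).2, Complex.zero_im, neg_zero, zero_div]
    have h2 : (lam : ℂ) * z i ^ 2 = (x i)⁻¹ := by rw [hx]; simp only [inv_inv]
    rw [← h2, Complex.im_ofReal_mul, sq, Complex.mul_im] at him
    have h3 : lam * (2 * (z i).re) * (z i).im = 0 := by linear_combination him
    have h4 := H.re_pos i
    exact (mul_eq_zero.mp h3).resolve_left (by positivity)
  · have hr : z i = ((z i).re : ℂ) := Complex.ext rfl (by simpa using h)
    rw [hx]
    simp only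
    rw [hr]
    exact_mod_cast (by positivity : 0 ≤ (lam * (z i).re ^ 2)⁻¹)

end Family

theorem analyticOrderAt_Xi_ne_top (hχ : χ ≠ 1) (w : ℂ) : analyticOrderAt (Xi χ) w ≠ ⊤ := by
  intro h
  rw [analyticOrderAt_eq_top] at h
  have h1 : Xi χ = fun _ => 0 := AnalyticOnNhd.eq_of_eventuallyEq (𝕜 := ℂ) (z₀ := w)
    (fun z _ => (differentiable_Xi hχ).analyticAt z) (fun z _ => analyticAt_const) h
  obtain ⟨z, hz⟩ := exists_Xi_ne_zero hχ
  exact hz (congrFun h1 z)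

theorem exists_isZeroList (hprim : χ.IsPrimitive) (hχ : χ ≠ 1)
    (hreal : ∀ x : ZMod m, (χ x).im = 0) (hphi : ∀ t : ℝ, 0 ≤ phi χ t) :
    ∃ z : ℕ → ℂ, IsZeroList χ z := by
  -- Each zero is repeated as often as its finite order. This tautological family is countably
  -- infinite, so it can be reindexed by ℕ.
  set ι := Σ w : {w : ℂ // 0 < w.re ∧ Xi χ w = 0}, Fin (analyticOrderNatAt (Xi χ) w)
  set z : ι → ℂ := fun i => i.1 with hz
  have H : IsZeroFamily χ z := by
    refine ⟨fun i => i.1.2.1, fun i => i.1.2.2, fun w hw hw0 => ?_⟩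
    set w' : {w : ℂ // 0 < w.re ∧ Xi χ w = 0} := ⟨w, hw, hw0⟩
    have hset : {k : ι | z k = w} = Set.range (Sigma.mk w') := by
      ext ⟨v, j⟩
      simp only [Set.mem_ofPred_eq, Set.mem_range, hz]
      constructor
      · intro h
        obtain rfl : v = w' := Subtype.ext h
        exact ⟨j, rfl⟩
      · rintro ⟨j', h⟩
        rw [← (Sigma.mk.inj_iff.mp h).1]
    rw [hset, ← Set.image_univ, sigma_mk_injective.encard_image, Set.encard_univ,
      ENat.card_eq_coe_fintype_card, Fintype.card_fin]
    exact Nat.cast_analyticOrderNatAt (analyticOrderAt_Xi_ne_top hχ w)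
  have := H.infinite hprim hχ hreal hphi
  have := H.countable hprim hχ hreal hphi
  obtain ⟨e⟩ := nonempty_equiv_of_countable (α := ℕ) (β := ι)
  refine ⟨z ∘ e, fun k => H.re_pos _, fun k => H.isZero _, fun w hw hw0 => ?_⟩
  rw [← H.multiplicity w hw hw0, ← e.injective.encard_image]
  congr 1
  ext i
  simp only [Set.mem_image, Set.mem_ofPred_eq, Function.comp_apply]
  exact ⟨fun ⟨k, hk, hki⟩ => hki ▸ hk, fun hi => ⟨e.symm i, by simpa using hi, by simp⟩⟩

theorem Xi_eq_zero_iff (hχ : χ ≠ 1) {z : ℂ} (hz : 0 < ((1 + 2 * Complex.I * z) / 2).re) :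
    Xi χ z = 0 ↔ DirichletCharacter.LFunction χ ((1 + 2 * Complex.I * z) / 2) = 0 := by
  have hm : (m : ℂ) ≠ 0 := by exact_mod_cast NeZero.ne m
  have hg0 : Complex.Gammaℝ ((1 + 2 * Complex.I * z) / 2 + parity χ) ≠ 0 :=
    Complex.Gammaℝ_ne_zero_of_re_pos (by
      rw [Complex.add_re, Complex.natCast_re]
      positivity)
  rw [Xi, completedLFunction_eq hχ hz, mul_eq_zero, mul_eq_zero, Complex.cpow_eq_zero_iff]
  simp [hm, hg0]

theorem half_add_re (z : ℂ) : ((1 + 2 * Complex.I * z) / 2).re = 1 / 2 - z.im := by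
  rw [show (1 + 2 * Complex.I * z) / 2 = 1 / 2 + Complex.I * z by ring]
  simp
  ring

/-- Nonvanishing of L on Re s ≥ 1 bounds Im z from below, and evenness of Ξ gives the other side. -/
theorem abs_im_lt_of_Xi_eq_zero (hprim : χ.IsPrimitive) (hχ : χ ≠ 1)
    (hreal : ∀ x : ZMod m, (χ x).im = 0) (hphi : ∀ t : ℝ, 0 ≤ phi χ t) {z : ℂ}
    (hz : Xi χ z = 0) : |z.im| < 1 / 2 := by
  have key : ∀ z, Xi χ z = 0 → -(1 / 2) < z.im := by
    intro z hz
    by_contra hcon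
    have h1 := half_add_re z
    rw [Xi_eq_zero_iff hχ (by rw [h1]; linarith)] at hz
    exact DirichletCharacter.LFunction_ne_zero_of_one_le_re χ (Or.inl hχ)
      (by rw [h1]; linarith) hz
  have h1 := key z hz
  have h2 := key (-z) (by rw [Xi_neg hprim hχ hreal hphi, hz])
  rw [Complex.neg_im] at h2
  rw [abs_lt]
  constructor <;> linarith

theorem IsZeroFamily.GRH_iff {ι : Type*} {z : ι → ℂ} (H : IsZeroFamily χ z)
    (hprim : χ.IsPrimitive) (hχ : χ ≠ 1)
    (hreal : ∀ x : ZMod m, (χ x).im = 0) (hphi : ∀ t : ℝ, 0 ≤ phi χ t) :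
    GRH χ ↔ ∀ i, (z i).im = 0 := by
  constructor
  · intro h i
    have h1 := abs_lt.mp (abs_im_lt_of_Xi_eq_zero hprim hχ hreal hphi (H.isZero i))
    have h2 := half_add_re (z i)
    have h3 := h ((1 + 2 * Complex.I * z i) / 2) (by linarith) (by linarith)
      ((Xi_eq_zero_iff hχ (by linarith)).mp (H.isZero i))
    linarith
  · intro h s hs0 hs1 hs
    have key : ∀ w : ℂ, 0 < w.re → Xi χ w = 0 → w.im = 0 := by
      intro w hw hw0
      have h1 : {k | z k = w}.encard ≠ 0 := by
        rw [H.multiplicity w hw hw0]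
        exact analyticOrderAt_ne_zero.mpr ⟨(differentiable_Xi hχ).analyticAt w, hw0⟩
      obtain ⟨k, hk⟩ := Set.encard_ne_zero.mp h1
      rw [Set.mem_ofPred_eq] at hk
      exact hk ▸ h k
    set w : ℂ := -Complex.I * (s - 1 / 2) with hw
    have hsw : (1 + 2 * Complex.I * w) / 2 = s := by
      rw [hw]
      linear_combination -(s - 1 / 2) * Complex.I_mul_I
    have hre := half_add_re w
    rw [hsw] at hre
    have hw0 : Xi χ w = 0 := by
      rw [Xi_eq_zero_iff hχ (by rw [hsw]; exact hs0), hsw]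
      exact hs
    have him : w.im = 0 := by
      -- The family only covers Re w > 0: evenness handles Re w < 0, and positivity of the kernel
      -- excludes Re w = 0.
      rcases lt_trichotomy w.re 0 with hlt | heq | hgt
      · have := key (-w) (by rw [Complex.neg_re]; linarith)
          (by rw [Xi_neg hprim hχ hreal hphi, hw0])
        rwa [Complex.neg_im, neg_eq_zero] at this
      · exact absurd hw0 (Xi_ne_zero_of_re_eq_zero hχ hreal hphi heq)
      · exact key w hgt hw0
    rw [hre, him, sub_zero]

end RealCharXi

/-! ### The theorem. -/

open RealCharXi

theorem corollary3p3 (m : ℕ) [NeZero m] (χ : DirichletCharacter ℂ m)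
    (hprim : χ.IsPrimitive) (hχ : χ ≠ 1) (hreal : ∀ x : ZMod m, (χ x).im = 0)
    (hphi : ∀ t : ℝ, 0 ≤ RealCharXi.phi χ t) :
    -- the moments converge, and there is a sequence of zeros to speak of
    (∀ n : ℕ, MeasureTheory.Integrable (fun t : ℝ => t ^ n * RealCharXi.phi χ t)) ∧
    0 < RealCharXi.b χ 0 ∧
    (∃ z : ℕ → ℂ, RealCharXi.IsZeroList χ z) ∧
    ∀ z : ℕ → ℂ, RealCharXi.IsZeroList χ z →
      -- the criterion
      (RealCharXi.GRH χ ↔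
        ∃ lam : ℝ, (∀ k : ℕ, 1 / ‖z k‖ ^ 2 ≤ lam) ∧
          RealCharXi.IsCompletelyMonotone
            (fun k => RealCharXi.powerSum z (k + 1) / (lam : ℂ) ^ (k + 1))) ∧
      -- the power sums converge and are the Taylor data of the logarithm
      (∀ n : ℕ, 1 ≤ n → Summable (fun k : ℕ => 1 / z k ^ (2 * n))) ∧
      AnalyticAt ℂ (fun w : ℂ =>
        Complex.log (RealCharXi.Xi χ (w ^ (1 / 2 : ℂ)) / RealCharXi.Xi χ 0)) 0 ∧
      (∀ n : ℕ, 1 ≤ n →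
        RealCharXi.powerSum z n = -1 / (Nat.factorial (n - 1) : ℂ) *
          iteratedDeriv n (fun w : ℂ =>
            Complex.log (RealCharXi.Xi χ (w ^ (1 / 2 : ℂ)) / RealCharXi.Xi χ 0)) 0) ∧
      -- the first three power sums
      RealCharXi.powerSum z 1 = ((RealCharXi.b χ 2 / (2 * RealCharXi.b χ 0) : ℝ) : ℂ) ∧
      RealCharXi.powerSum z 2 =
        (((3 * RealCharXi.b χ 2 ^ 2 - RealCharXi.b χ 0 * RealCharXi.b χ 4) /
          (12 * RealCharXi.b χ 0 ^ 2) : ℝ) : ℂ) ∧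
      RealCharXi.powerSum z 3 =
        (((30 * RealCharXi.b χ 2 ^ 3
            - 15 * RealCharXi.b χ 0 * RealCharXi.b χ 2 * RealCharXi.b χ 4
            + RealCharXi.b χ 0 ^ 2 * RealCharXi.b χ 6) /
          (240 * RealCharXi.b χ 0 ^ 3) : ℝ) : ℂ) ∧
      -- the recurrence
      (∀ k : ℕ, 1 ≤ k →
        RealCharXi.powerSum z k =
          (-1 : ℂ) ^ (k - 1) * k * (RealCharXi.b χ (2 * k) : ℂ) /
              ((Nat.factorial (2 * k) : ℂ) * (RealCharXi.b χ 0 : ℂ)) +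
            ∑ i ∈ Finset.Icc 1 (k - 1),
              (-1 : ℂ) ^ (k - 1 + i) * (RealCharXi.b χ (2 * k - 2 * i) : ℂ) /
                ((Nat.factorial (2 * k - 2 * i) : ℂ) * (RealCharXi.b χ 0 : ℂ)) *
                RealCharXi.powerSum z i) ∧
      -- the closed formula
      (∀ k : ℕ, 1 ≤ k →
        RealCharXi.powerSum z k =
          ∑ r ∈ RealCharXi.weightedTuples k,
            (-1 : ℂ) ^ k *
              ((k : ℂ) * (Nat.factorial ((∑ i, r i) - 1) : ℂ) /
                (∏ i, (Nat.factorial (r i) : ℂ))) *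
              ∏ i : Fin k,
                (-(RealCharXi.b χ (2 * ((i : ℕ) + 1)) : ℂ) /
                  ((Nat.factorial (2 * ((i : ℕ) + 1)) : ℂ) * (RealCharXi.b χ 0 : ℂ))) ^ r i) := by
  refine ⟨integrable_pow_mul_phi hχ hreal, b_zero_pos hχ hreal hphi,
    exists_isZeroList hprim hχ hreal hphi, fun z hz => ?_⟩
  have H := hz.isZeroFamily
  have hb : ((b χ 0 : ℝ) : ℂ) ≠ 0 := by exact_mod_cast (b_zero_pos hχ hreal hphi).ne'
  have hbr : b χ 0 ≠ 0 := (b_zero_pos hχ hreal hphi).ne'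
  have hrec : ∀ k, powerSum z (k + 1) = -((k + 1) * xiCoeff χ (k + 1)) -
      ∑ j ∈ Finset.range k, powerSum z (j + 1) * xiCoeff χ (k - j) :=
    H.tsum_recurrence hprim hχ hreal hphi
  have h1 : powerSum z 1 = ((b χ 2 / (2 * b χ 0) : ℝ) : ℂ) := by
    rw [hrec 0]
    simp [xiCoeff]
    field_simp
  have h2 : powerSum z 2 =
      (((3 * b χ 2 ^ 2 - b χ 0 * b χ 4) / (12 * b χ 0 ^ 2) : ℝ) : ℂ) := by
    rw [hrec 1]
    simp [xiCoeff, h1, Nat.factorial]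
    field_simp
    ring
  have h3 : powerSum z 3 =
      (((30 * b χ 2 ^ 3 - 15 * b χ 0 * b χ 2 * b χ 4 + b χ 0 ^ 2 * b χ 6) /
        (240 * b χ 0 ^ 3) : ℝ) : ℂ) := by
    rw [hrec 2]
    simp [xiCoeff, h1, h2, Nat.factorial, Finset.sum_range_succ]
    field_simp
    ring
  refine ⟨?_, ?_, ?_, ?_, h1, h2, h3, ?_, ?_⟩
  · rw [H.GRH_iff hprim hχ hreal hphi]
    constructor
    · intro h
      have hs := H.summable_norm_inv_sq hprim hχ hreal hphi
      -- The sum of all |z_i|^(-2) serves as λ, since it bounds each of its terms.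
      have hle : ∀ k, 1 / ‖z k‖ ^ 2 ≤ ∑' i, (‖z i‖ ^ 2)⁻¹ := fun k => by
        rw [one_div]
        exact hs.le_tsum k fun i _ => by positivity
      have hpos : 0 < 1 / ‖z 0‖ ^ 2 := by
        have := norm_pos_iff.mpr (H.ne_zero 0)
        positivity
      exact ⟨_, hle, (H.isCompletelyMonotone_iff hprim hχ hreal hphi
        (hpos.trans_le (hle 0)) hle).mpr h⟩
    · rintro ⟨lam, hle, hmono⟩
      have hpos : 0 < 1 / ‖z 0‖ ^ 2 := by
        have := norm_pos_iff.mpr (H.ne_zero 0)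
        positivity
      exact (H.isCompletelyMonotone_iff hprim hχ hreal hphi
        (hpos.trans_le (hle 0)) hle).mp hmono
  · rintro (_ | n) hn
    · omega
    · exact H.summable_pow hprim hχ hreal hphi n
  · refine ((differentiable_xiSqrt hprim hχ hreal hphi).analyticAt 0).clog ?_
    rw [xiSqrt_zero hχ hreal hphi]
    exact Complex.one_mem_slitPlane
  · rintro (_ | n) hn
    · omega
    · have hf : (n.factorial : ℂ) ≠ 0 := by exact_mod_cast n.factorial_ne_zero
      have := H.factorial_mul_tsum hprim hχ hreal hphi n
      change _ = _ * iteratedDeriv (n + 1) (fun w => Complex.log (xiSqrt χ w)) 0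
      rw [Nat.add_sub_cancel, ← neg_eq_iff_eq_neg.mpr this, powerSum]
      field_simp
  · rintro (_ | k) hk
    · omega
    · rw [hrec, Nat.add_sub_cancel, ← Finset.Ico_add_one_right_eq_Icc,
        Finset.sum_Ico_eq_sum_range, Nat.add_sub_cancel, sub_eq_add_neg, ← Finset.sum_neg_distrib]
      congr 1
      · rw [xiCoeff, pow_succ]
        push_cast
        ring
      · refine Finset.sum_congr rfl fun i hi => ?_
        rw [Finset.mem_range] at hi
        obtain ⟨d, rfl⟩ : ∃ d, k = i + 1 + d := ⟨k - i - 1, by omega⟩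
        rw [xiCoeff, show i + 1 + d - i = d + 1 by omega,
          show 2 * (i + 1 + d + 1) - 2 * (1 + i) = 2 * (d + 1) by omega, add_comm 1 i,
          show (-1 : ℂ) ^ (i + 1 + d + (i + 1)) = (-1) ^ d by
            rw [show i + 1 + d + (i + 1) = d + 2 * (i + 1) by ring, pow_add, pow_mul]
            simp]
        ring
  · intro k hk
    rw [NewtonSeries.eq_sum_weightedTuples (x := fun n => -xiCoeff χ n) (S := powerSum z)
      (fun k => by
        rw [hrec k]
        simp only [mul_neg, Finset.sum_neg_distrib]
        ring) hk]
    refine Finset.sum_congr rfl fun r hr => ?_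
    have hprod : ∏ i : Fin k, (-xiCoeff χ ((i : ℕ) + 1)) ^ r i = (-1) ^ k *
        ∏ i : Fin k, (-(b χ (2 * ((i : ℕ) + 1)) : ℂ) /
          ((Nat.factorial (2 * ((i : ℕ) + 1)) : ℂ) * (b χ 0 : ℂ))) ^ r i := by
      -- The signs (-1)^(i+1) inside `xiCoeff` combine to (-1)^k because the tuple has weight k.
      have hsign : (-1 : ℂ) ^ k = ∏ i : Fin k, (-1 : ℂ) ^ (((i : ℕ) + 1) * r i) := by
        rw [Finset.prod_pow_eq_pow_sum, mem_weightedTuples.mp hr]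
      rw [hsign, ← Finset.prod_mul_distrib]
      refine Finset.prod_congr rfl fun i _ => ?_
      rw [pow_mul, ← mul_pow, xiCoeff]
      congr 1
      ring
    rw [hprod]
    ring
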